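/- **Setting.** For $\theta>0$ let $L_\theta=\log(I+(-\Delta)^\theta)$ be the operator in $L^2(\mathbf R)$ with domain $D(L_\theta)=\{f\in L^2(\mathbf R):\log(1+|\xi|^{2\theta})\hat f(\xi)\in L^2(\mathbf R_\xi)\}$ and $L_\theta f=\mathcal F^{-1}\big(\log(1+|\xi|^{2\theta})\hat f\,\big)$, where $\hat f(\xi)=\int_{\mathbf R}e^{-ix\xi}f(x)\,dx$. Functions may be complex-valued, and $\|\cdot\|$ is the norm of $L^2(\mathbf R)$. For $u_1\in L^2(\mathbf R)$ let $u\in C([0,\infty);H^1(\mathbf R))\cap C^1([0,\infty);L^2(\mathbf R))$ be the mild solution of $$u_{tt}-\Delta u+L_\theta u_t=0\quad (t>0,\ x\in\mathbf R),\qquad u(0,\cdot)=0,\quad u_t(0,\cdot)=u_1,$$ that is, $u(0)=0$ and, for all $t\ge0$, $\int_0^t u(s)\,ds\in H^2(\mathbf R)$ and $u_t(t)=u_1+\Delta\int_0^t u(s)\,ds-L_\theta u(t)$. Put $P_1=\int_{\mathbf R}u_1(x)\,dx$ and $$\|f\|_{L^{1,2\theta}}=\int_{\mathbf R}(1+|x|^{2\theta})|f(x)|\,dx,\qquad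 L^{1,2\theta}(\mathbf R)=\{f\in L^1(\mathbf R):\|f\|_{L^{1,2\theta}}<\infty\}.$$ **Theorem 1.3.** Let $\frac14\le\theta\le\frac13$. There are constants $K_1,K_2>0$ and $T\in\mathbf R$, depending only on $\theta$, such that for every $u_1\in L^{1,2\theta}(\mathbf R)\cap L^2(\mathbf R)$ there is $T'\in\mathbf R$ for which the following holds. If $\frac14<\theta\le\frac13$, then $$K_1|P_1|\,t^{\frac{4\theta-1}{4\theta}}\le\|u(t,\cdot)\|\ \ (t\ge T'),\qquad \|u(t,\cdot)\|\le K_2\Big(\frac{1}{\sqrt{4\theta-1}}|P_1|+\|u_1\|_{L^{1,2\theta}}\Big)t^{\frac{4\theta-1}{4\theta}}\ \ (t\ge T).$$ If $\theta=\frac14$, then $$K_1|P_1|\sqrt{\log t}\le\|u(t,\cdot)\|\ \ (t\ge T'),\qquad \|u(t,\cdot)\|\le K_2\big(|P_1|+\|u_1\|_{L^{1,2\theta}}\big)\sqrt{\log t}\ \ (t\ge T).$$ -/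

import Mathlib

open MeasureTheory Set Filter
open scoped FourierTransform SchwartzMap Laplacian LineDeriv ENNReal

noncomputable section

namespace LogDampedWave

/-- The space `L²(ℝ)` of complex-valued functions, with norm `‖·‖`. -/
abbrev L2 : Type := Lp ℂ 2 (volume : Measure ℝ)

/-- The symbol `log (1 + |ξ|^{2θ})` of the damping operator. -/
def logSymbol (θ ξ : ℝ) : ℝ := Real.log (1 + |ξ| ^ (2 * θ))

/-- The symbol in the frequency variable of Mathlib's Fourier transform, whose kernel is
`e^{-2πixξ}`: the angular frequency (kernel `e^{-ixξ}`) is `2πξ`. -/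
def logMul (θ : ℝ) (f : L2) : ℝ → ℂ :=
  fun ξ => (logSymbol θ (2 * Real.pi * ξ) : ℂ) * (𝓕 f : L2) ξ

lemma logMul_add (θ : ℝ) (f g : L2) : logMul θ (f + g) =ᵐ[volume] logMul θ f + logMul θ g := by
  have h : (𝓕 (f + g) : L2) = 𝓕 f + 𝓕 g := FourierTransform.fourier_add f g
  unfold logMul
  rw [h]
  filter_upwards [Lp.coeFn_add (𝓕 f : L2) (𝓕 g)] with ξ hξ
  rw [hξ]
  simp [mul_add]

lemma logMul_smul (θ : ℝ) (c : ℂ) (f : L2) : logMul θ (c • f) =ᵐ[volume] c • logMul θ f := by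
  have h : (𝓕 (c • f) : L2) = c • 𝓕 f := FourierTransform.fourier_smul c f
  unfold logMul
  rw [h]
  filter_upwards [Lp.coeFn_smul c (𝓕 f : L2)] with ξ hξ
  rw [hξ]
  simp [mul_left_comm]

/-- The domain `D(L_θ)`: those `f ∈ L²` with `log (1 + |ξ|^{2θ}) f̂(ξ) ∈ L²`. -/
def logDampingDomain (θ : ℝ) : Submodule ℂ L2 where
  carrier := {f | MemLp (logMul θ f) 2 volume}
  zero_mem' := by
    have h := logMul_smul θ 0 0
    simp only [zero_smul] at h
    exact (memLp_congr_ae h).2 MemLp.zero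
  add_mem' := fun {f g} hf hg => (memLp_congr_ae (logMul_add θ f g)).2 (hf.add hg)
  smul_mem' := fun c f hf => (memLp_congr_ae (logMul_smul θ c f)).2 (hf.const_smul c)

/-- The operator `L_θ = log (I + (-Δ)^θ)` in `L²(ℝ)`, with domain `D(L_θ)`:
`L_θ f = 𝓕⁻¹ (log (1 + |ξ|^{2θ}) f̂)`. -/
def logDamping (θ : ℝ) : L2 →ₗ.[ℂ] L2 where
  domain := logDampingDomain θ
  toFun :=
    { toFun := fun f => 𝓕⁻ (MemLp.toLp (logMul θ f.1) f.2)
      map_add' := fun f g => by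
        rw [← FourierTransform.fourierInv_add, ← MemLp.toLp_add f.2 g.2]
        exact congrArg _ (MemLp.toLp_congr _ _ (logMul_add θ f.1 g.1))
      map_smul' := fun c f => by
        rw [RingHom.id_apply, ← FourierTransform.fourierInv_smul,
          ← MemLp.toLp_const_smul c f.2]
        exact congrArg _ (MemLp.toLp_congr _ _ (logMul_smul θ c f.1)) }

/-- `f' = g` in the sense of (tempered) distributions, for `f, g ∈ L²(ℝ)`. -/
def HasWeakDeriv (f g : L2) : Prop :=
  ∂_{(1 : ℝ)} (f : 𝓢'(ℝ, ℂ)) = (g : 𝓢'(ℝ, ℂ))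

/-- `Δ f = g` in the sense of (tempered) distributions, for `f, g ∈ L²(ℝ)`; the functions
`f ∈ L²(ℝ)` for which such a `g` exists are those of `H²(ℝ)`. -/
def HasWeakLaplacian (f g : L2) : Prop :=
  Δ (f : 𝓢'(ℝ, ℂ)) = (g : 𝓢'(ℝ, ℂ))

/-- `u ∈ C([0,∞); H¹(ℝ))`: `u` and its weak derivative `∂ₓu` are continuous from `[0,∞)`
to `L²(ℝ)`. -/
def ContinuousInH1 (u : ℝ → L2) : Prop :=
  ContinuousOn u (Ici 0) ∧
    ∃ w : ℝ → L2, ContinuousOn w (Ici 0) ∧ ∀ t, 0 ≤ t → HasWeakDeriv (u t) (w t)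

/-- `u ∈ C([0,∞); H¹) ∩ C¹([0,∞); L²)` is a mild solution of
`u_tt - Δu + L_θ u_t = 0`, `u(0) = u₀`, `u_t(0) = u₁`.

Written as the first-order system `U' = AU` for `U = (u, u_t)` in `H¹ × L²`, with
`A (f, g) = (g, Δf - L_θ g)`, a mild solution is a continuous `U` such that
`U(t) = U(0) + A ∫₀ᵗ U(s) ds` for all `t ≥ 0`. The first component says that `v` below is the time
derivative of `u`, so that `∫₀ᵗ v(s) ds = u(t) - u₀`; the second one is
`v(t) = u₁ + Δ ∫₀ᵗ u(s) ds - L_θ (u(t) - u₀)`. Only the values `u t`, `t ≥ 0`, matter. -/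
def IsMildSolution (θ : ℝ) (u₀ u₁ : L2) (u : ℝ → L2) : Prop :=
  u 0 = u₀ ∧ ContinuousInH1 u ∧
    ∃ v : ℝ → L2, ContinuousOn v (Ici 0) ∧
      (∀ t, 0 ≤ t → HasDerivWithinAt u (v t) (Ici 0) t) ∧
      ∀ t, 0 ≤ t → ∃ (a : L2) (h : u t - u₀ ∈ (logDamping θ).domain),
        HasWeakLaplacian (∫ s in (0 : ℝ)..t, u s) a ∧
        v t = u₁ + a - logDamping θ ⟨u t - u₀, h⟩

/-- Membership in the weighted space `L^{1,γ}(ℝ)`. -/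
def MemWeightedL1 (γ : ℝ) (f : ℝ → ℂ) : Prop :=
  Integrable f ∧ Integrable (fun x => (1 + |x| ^ γ) * ‖f x‖)

/-- The norm `∫ (1 + |x|^γ) |f(x)| dx` of `L^{1,γ}(ℝ)`. -/
def weightedL1Norm (γ : ℝ) (f : ℝ → ℂ) : ℝ := ∫ x, (1 + |x| ^ γ) * ‖f x‖

/-- The moment `P₁ = ∫ u₁(x) dx`. -/
def moment (f : ℝ → ℂ) : ℂ := ∫ x, f x

end LogDampedWave

end

namespace LogDampedWave

open scoped Topology InnerProductSpace

/-! ### The Fourier transform on `L²(ℝ)` -/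

/-! With `η = 2πξ` and `l = log (1 + |η|^{2θ})`, a mild solution satisfies `û(t) = m(t) û₁`, where
`m = oscillator l η` solves `m'' + l m' + η² m = 0`, `m(0) = 0`, `m'(0) = 1`. By Plancherel the
theorem is a statement about the size of `∫ |m(t)|² |û₁|²`, and only low frequencies matter.

Near `η = 0` one has `l ≈ |η|^{2θ}`, which is much larger than `|η|` since `2θ ≤ 2/3`, so the
oscillator is overdamped: it grows like `t` while `l t ≤ 1`, then stays near `1 / l` until the time
`l / η²`. Hence `m(t)` is about `t` for `|η| ≤ ρ = t^{-1/(2θ)}` and at most a multiple of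
`|η|^{-2θ}` for `ρ ≤ |η| ≤ 1`. The inner region contributes `t² ρ = (t^{(4θ-1)/(4θ)})²`, the outer
one `∫_ρ^1 x^{-4θ} dx`: of the same order if `4θ > 1`, equal to `2 log t` if `4θ = 1`.

For the upper bounds, `|û₁|` is bounded by the `L¹` norm and `m²` by `majorant`
(`oscillator_sq_le_majorant`, `majorant_integral`). For the lower bounds, `|û₁| ≥ |P₁| / 2` near `0`
by continuity, and `m` is bounded below on `|η| ≤ ρ` (`le_oscillator_of_mul_le_one`) or, if `θ =
1/4`, on a window of logarithmic length comparable to `log t` (`le_oscillator_of_one_le_mul`).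

The formula for `û` has to be derived from the integrated equation alone;
`inner_indicator_eq_of_equation` does this by duality, on bounded sets of frequencies. -/

lemma continuous_fourier_integral {f : ℝ → ℂ} (hf : Integrable f) : Continuous (𝓕 f) :=
  VectorFourier.fourierIntegral_continuous Real.continuous_fourierChar (by fun_prop) hf

/-- On `L¹ ∩ L²` the `L²` Fourier transform is given by the Fourier integral. -/
lemma fourier_ae_eq_integral (f : L2) (hf : Integrable f) :
    ((𝓕 f : L2) : ℝ → ℂ) =ᵐ[volume] 𝓕 (f : ℝ → ℂ) := by
  refine ae_eq_of_integral_contDiff_smul_eq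
    ((Lp.memLp (𝓕 f : L2)).locallyIntegrable (by norm_num)) (continuous_fourier_integral hf).locallyIntegrable ?_
  intro g g_smooth g_cpt
  have hg₁ : HasCompactSupport (Complex.ofRealCLM ∘ g) := g_cpt.comp_left rfl
  have hg₂ : ContDiff ℝ (⊤ : ℕ∞) (Complex.ofRealCLM ∘ g) := by fun_prop
  set G : 𝓢(ℝ, ℂ) := hg₁.toSchwartzMap hg₂ with hG
  have h1 : ∫ x, g x • (𝓕 f : L2) x = ((𝓕 f : L2) : 𝓢'(ℝ, ℂ)) G := by
    rw [Lp.toTemperedDistribution_apply]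
    simp [hG]
  rw [h1, ← Lp.fourier_toTemperedDistribution_eq, TemperedDistribution.fourier_apply,
    Lp.toTemperedDistribution_apply, SchwartzMap.fourier_coe]
  -- Fubini moves the Fourier integral from the test function to `f`; this is where integrability of
  -- `f` enters.
  have h2 := VectorFourier.integral_fourierIntegral_smul_eq_flip (L := innerₗ ℝ)
    (μ := volume) (ν := volume) (f := (G : ℝ → ℂ)) (g := (f : ℝ → ℂ)) Real.continuous_fourierChar
      (by fun_prop) G.integrable hf
  refine Eq.trans h2 ?_
  simp only [flip_innerₗ]
  refine integral_congr_ae (Eventually.of_forall fun x => ?_)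
  simp [hG]
  left
  rfl

lemma norm_fourier_integral_le (f : ℝ → ℂ) (ξ : ℝ) : ‖𝓕 f ξ‖ ≤ ∫ x, ‖f x‖ :=
  VectorFourier.norm_fourierIntegral_le_integral_norm _ _ _ _ _

lemma fourier_integral_zero (f : ℝ → ℂ) : 𝓕 f 0 = moment f := by
  simp [Real.fourier_eq, moment]

/-- If the distributions of two `L²` functions agree up to a multiplier of temperate growth, then
so do the functions. -/
lemma ae_eq_smul_of_toTemperedDistribution {f g : L2} {m : ℝ → ℂ} (hm : m.HasTemperateGrowth)
    (h : (g : 𝓢'(ℝ, ℂ)) = TemperedDistribution.smulLeftCLM ℂ m (f : 𝓢'(ℝ, ℂ))) :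
    (g : ℝ → ℂ) =ᵐ[volume] fun ξ => m ξ * f ξ := by
  have hmc : Continuous m := hm.1.continuous
  refine ae_eq_of_integral_contDiff_smul_eq
    ((Lp.memLp g).locallyIntegrable (by norm_num)) ?_ ?_
  · simpa only [smul_eq_mul, mul_comm] using
      ((Lp.memLp f).locallyIntegrable (by norm_num)).smul_continuous hmc
  intro φ φ_smooth φ_cpt
  have hφ₁ : HasCompactSupport (Complex.ofRealCLM ∘ φ) := φ_cpt.comp_left rfl
  have hφ₂ : ContDiff ℝ (⊤ : ℕ∞) (Complex.ofRealCLM ∘ φ) := by fun_prop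
  set G : 𝓢(ℝ, ℂ) := hφ₁.toSchwartzMap hφ₂ with hG
  have h1 : ∫ x, φ x • g x = (g : 𝓢'(ℝ, ℂ)) G := by
    rw [Lp.toTemperedDistribution_apply]
    simp [hG]
  rw [h1, h, TemperedDistribution.smulLeftCLM_apply_apply, Lp.toTemperedDistribution_apply]
  refine integral_congr_ae (Eventually.of_forall fun x => ?_)
  simp [hG, hm, SchwartzMap.smulLeftCLM_apply_apply]
  ring

/-- The weak Laplacian is multiplication by `-(2πξ)²` on the Fourier side. -/
lemma HasWeakLaplacian.fourier_ae_eq {f g : L2} (h : HasWeakLaplacian f g) :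
    ((𝓕 g : L2) : ℝ → ℂ) =ᵐ[volume]
      fun ξ => -(((2 * Real.pi * ξ) ^ 2 : ℝ) : ℂ) * (𝓕 f : L2) ξ := by
  have hm : (fun x : ℝ => Complex.ofReal (‖x‖ ^ 2)).HasTemperateGrowth := by fun_prop
  have hm' : ((-((2 * Real.pi : ℝ) : ℂ) ^ 2) •
      (fun x : ℝ => Complex.ofReal (‖x‖ ^ 2))).HasTemperateGrowth := by
    show (fun x : ℝ => (-((2 * Real.pi : ℝ) : ℂ) ^ 2) * Complex.ofReal (‖x‖ ^ 2)).HasTemperateGrowth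
    fun_prop
  have key := ae_eq_smul_of_toTemperedDistribution (f := 𝓕 f) (g := 𝓕 g) hm' (by
    rw [← Lp.fourier_toTemperedDistribution_eq, ← Lp.fourier_toTemperedDistribution_eq,
      ← show _ = _ from h, TemperedDistribution.laplacian_eq_fourierMultiplierCLM,
      TemperedDistribution.fourierMultiplierCLM_apply, TemperedDistribution.smulLeftCLM_smul hm]
    ext u
    simp)
  filter_upwards [key] with ξ hξ
  rw [hξ]
  simp
  left
  ring

/-! ### The damped oscillator `y'' + l y' + q² y = 0` -/

/-- The solution of `y'' = D y`, `y(0) = 0`, `y'(0) = 1`. -/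
noncomputable def sineSol (D t : ℝ) : ℝ :=
  if 0 < D then Real.sinh (√D * t) / √D else if D = 0 then t else Real.sin (√(-D) * t) / √(-D)

/-- The solution of `y'' = D y`, `y(0) = 1`, `y'(0) = 0`. -/
noncomputable def cosineSol (D t : ℝ) : ℝ :=
  if 0 < D then Real.cosh (√D * t) else Real.cos (√(-D) * t)

lemma hasDerivAt_sineSol (D t : ℝ) : HasDerivAt (sineSol D) (cosineSol D t) t := by
  unfold sineSol cosineSol
  rcases lt_trichotomy D 0 with h | h | h
  · have hs : √(-D) ≠ 0 := (Real.sqrt_pos.2 (by linarith)).ne'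
    simp only [h.not_gt, h.ne, if_false]
    have := (((hasDerivAt_id' t).const_mul √(-D)).sin).div_const √(-D)
    refine this.congr_deriv ?_
    field_simp
  · subst h
    simpa using hasDerivAt_id' t
  · have hs : √D ≠ 0 := (Real.sqrt_pos.2 h).ne'
    simp only [h, if_true]
    have := (((hasDerivAt_id' t).const_mul √D).sinh).div_const √D
    refine this.congr_deriv ?_
    field_simp

lemma hasDerivAt_cosineSol (D t : ℝ) : HasDerivAt (cosineSol D) (D * sineSol D t) t := by
  unfold sineSol cosineSol
  rcases lt_trichotomy D 0 with h | h | h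
  · have hs : √(-D) ≠ 0 := (Real.sqrt_pos.2 (by linarith)).ne'
    have hsq : √(-D) * √(-D) = -D := Real.mul_self_sqrt (by linarith)
    simp only [h.not_gt, h.ne, if_false]
    have := ((hasDerivAt_id' t).const_mul √(-D)).cos
    convert this using 1
    field_simp
    linear_combination (Real.sin (√(-D) * t)) * hsq
  · subst h
    simpa using hasDerivAt_const t (1 : ℝ)
  · have hs : √D ≠ 0 := (Real.sqrt_pos.2 h).ne'
    have hsq : √D * √D = D := Real.mul_self_sqrt h.le
    simp only [h, if_true]
    have := ((hasDerivAt_id' t).const_mul √D).cosh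
    convert this using 1
    field_simp
    linear_combination (-Real.sinh (√D * t)) * hsq

lemma measurable_sineSol (t : ℝ) : Measurable fun D => sineSol D t := by
  unfold sineSol
  exact Measurable.ite measurableSet_Ioi (by fun_prop)
    (Measurable.ite (measurableSet_singleton 0) (by fun_prop) (by fun_prop))

lemma measurable_cosineSol (t : ℝ) : Measurable fun D => cosineSol D t := by
  unfold cosineSol
  exact Measurable.ite measurableSet_Ioi (by fun_prop) (by fun_prop)

@[simp] lemma sineSol_zero (D : ℝ) : sineSol D 0 = 0 := by simp [sineSol]

@[simp] lemma cosineSol_zero (D : ℝ) : cosineSol D 0 = 1 := by simp [cosineSol]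

/-- The solution of `y'' + l y' + q² y = 0`, `y(0) = 0`, `y'(0) = 1`. -/
noncomputable def oscillator (l q t : ℝ) : ℝ :=
  Real.exp (-(l / 2 * t)) * sineSol (l ^ 2 / 4 - q ^ 2) t

/-- The time derivative of `oscillator`. -/
noncomputable def oscillatorDeriv (l q t : ℝ) : ℝ :=
  Real.exp (-(l / 2 * t)) *
    (cosineSol (l ^ 2 / 4 - q ^ 2) t - l / 2 * sineSol (l ^ 2 / 4 - q ^ 2) t)

@[simp] lemma oscillator_zero (l q : ℝ) : oscillator l q 0 = 0 := by simp [oscillator]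

@[simp] lemma oscillatorDeriv_zero (l q : ℝ) : oscillatorDeriv l q 0 = 1 := by
  simp [oscillatorDeriv]

lemma hasDerivAt_oscillator (l q t : ℝ) :
    HasDerivAt (oscillator l q) (oscillatorDeriv l q t) t := by
  have h1 : HasDerivAt (fun t => Real.exp (-(l / 2 * t)))
      (Real.exp (-(l / 2 * t)) * -(l / 2)) t := by
    simpa using (((hasDerivAt_id' t).const_mul (l / 2)).neg).exp
  refine (h1.mul (hasDerivAt_sineSol (l ^ 2 / 4 - q ^ 2) t)).congr_deriv ?_
  unfold oscillatorDeriv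
  ring

lemma hasDerivAt_oscillatorDeriv (l q t : ℝ) :
    HasDerivAt (oscillatorDeriv l q)
      (-l * oscillatorDeriv l q t - q ^ 2 * oscillator l q t) t := by
  have h1 : HasDerivAt (fun t => Real.exp (-(l / 2 * t)))
      (Real.exp (-(l / 2 * t)) * -(l / 2)) t := by
    simpa using (((hasDerivAt_id' t).const_mul (l / 2)).neg).exp
  refine (h1.mul ((hasDerivAt_cosineSol (l ^ 2 / 4 - q ^ 2) t).sub
    ((hasDerivAt_sineSol (l ^ 2 / 4 - q ^ 2) t).const_mul (l / 2)))).congr_deriv ?_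
  unfold oscillatorDeriv oscillator
  simp only [Pi.sub_apply]
  ring

lemma measurable_oscillator {l q : ℝ → ℝ} (hl : Measurable l) (hq : Measurable q) (t : ℝ) :
    Measurable fun ξ => oscillator (l ξ) (q ξ) t := by
  unfold oscillator
  have := (measurable_sineSol t).comp (((hl.pow_const 2).div_const 4).sub (hq.pow_const 2))
  exact Measurable.mul (by fun_prop) this

lemma measurable_oscillatorDeriv {l q : ℝ → ℝ} (hl : Measurable l) (hq : Measurable q) (t : ℝ) :
    Measurable fun ξ => oscillatorDeriv (l ξ) (q ξ) t := by
  unfold oscillatorDeriv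
  have h1 := (measurable_sineSol t).comp (((hl.pow_const 2).div_const 4).sub (hq.pow_const 2))
  have h2 := (measurable_cosineSol t).comp (((hl.pow_const 2).div_const 4).sub (hq.pow_const 2))
  exact Measurable.mul (by fun_prop) (h2.sub ((hl.div_const 2).mul h1))

/-- The energy of the damped oscillator does not exceed its initial value. -/
lemma oscillator_energy_le {l : ℝ} (hl : 0 ≤ l) (q : ℝ) {t : ℝ} (ht : 0 ≤ t) :
    oscillatorDeriv l q t ^ 2 + q ^ 2 * oscillator l q t ^ 2 ≤ 1 := by
  have hd : ∀ s, HasDerivAt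
      (fun s => oscillatorDeriv l q s ^ 2 + q ^ 2 * oscillator l q s ^ 2)
      (-(2 * l * oscillatorDeriv l q s ^ 2)) s := fun s => by
    refine (((hasDerivAt_oscillatorDeriv l q s).pow 2).add
      (((hasDerivAt_oscillator l q s).pow 2).const_mul (q ^ 2))).congr_deriv ?_
    push_cast
    ring
  have hanti := antitone_of_hasDerivAt_nonpos hd (fun s => by
    simp only [Pi.zero_apply]
    nlinarith [mul_nonneg hl (sq_nonneg (oscillatorDeriv l q s))])
  simpa using hanti ht

lemma abs_oscillatorDeriv_le {l : ℝ} (hl : 0 ≤ l) (q : ℝ) {t : ℝ} (ht : 0 ≤ t) :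
    |oscillatorDeriv l q t| ≤ 1 := by
  have := oscillator_energy_le hl q ht
  rw [← sq_le_one_iff_abs_le_one]
  nlinarith [mul_nonneg (sq_nonneg q) (sq_nonneg (oscillator l q t))]

lemma abs_mul_abs_oscillator_le {l : ℝ} (hl : 0 ≤ l) (q : ℝ) {t : ℝ} (ht : 0 ≤ t) :
    |q| * |oscillator l q t| ≤ 1 := by
  have := oscillator_energy_le hl q ht
  rw [← abs_mul, ← sq_le_one_iff_abs_le_one]
  nlinarith [sq_nonneg (oscillatorDeriv l q t)]

lemma abs_oscillator_le {l : ℝ} (hl : 0 ≤ l) (q : ℝ) {t : ℝ} (ht : 0 ≤ t) :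
    |oscillator l q t| ≤ t := by
  have := (convex_Ici (0 : ℝ)).norm_image_sub_le_of_norm_hasDerivWithin_le
    (f := oscillator l q) (C := 1) (fun s _ => (hasDerivAt_oscillator l q s).hasDerivWithinAt)
    (fun s hs => abs_oscillatorDeriv_le hl q hs) (mem_Ici.2 le_rfl) (mem_Ici.2 ht)
  simpa [abs_of_nonneg ht] using this

lemma oscillator_eq_of_pos {l q : ℝ} (h : 0 < l ^ 2 / 4 - q ^ 2) (t : ℝ) :
    oscillator l q t =
      Real.exp (-(l / 2 * t)) * (Real.sinh (√(l ^ 2 / 4 - q ^ 2) * t) / √(l ^ 2 / 4 - q ^ 2)) := by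
  simp [oscillator, sineSol, h]

lemma sqrt_discriminant_le {l : ℝ} (hl : 0 ≤ l) (q : ℝ) : √(l ^ 2 / 4 - q ^ 2) ≤ l / 2 := by
  refine Real.sqrt_le_iff.2 ⟨by positivity, ?_⟩
  nlinarith [sq_nonneg q]

/-- The damping alone bounds the solution, uniformly in `q`. If the discriminant is at least `l² /
16`, the `sinh` formula has `k ≥ l / 4` and the product of the exponential factors is at most `1`.
Otherwise `q² > 3l² / 16`, so `l ≤ 3|q|` and the energy bound applies. -/
lemma mul_abs_oscillator_le {l : ℝ} (hl : 0 ≤ l) (q : ℝ) {t : ℝ} (ht : 0 ≤ t) :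
    l * |oscillator l q t| ≤ 3 := by
  rcases hl.eq_or_lt with rfl | hl0
  · simp
  by_cases h : l ^ 2 / 16 ≤ l ^ 2 / 4 - q ^ 2
  · have hD : 0 < l ^ 2 / 4 - q ^ 2 := lt_of_lt_of_le (by positivity) h
    have hk : l / 4 ≤ √(l ^ 2 / 4 - q ^ 2) := Real.le_sqrt_of_sq_le (by nlinarith)
    have hk' := sqrt_discriminant_le hl q
    rw [oscillator_eq_of_pos hD]
    set k := √(l ^ 2 / 4 - q ^ 2)
    have hk0 : 0 < k := lt_of_lt_of_le (by positivity) hk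
    have hs0 : 0 ≤ Real.sinh (k * t) := Real.sinh_nonneg_iff.2 (by positivity)
    have hs : Real.sinh (k * t) ≤ Real.exp (k * t) / 2 := by
      rw [Real.sinh_eq]
      linarith [Real.exp_pos (-(k * t))]
    have he : Real.exp (-(l / 2 * t)) * Real.exp (k * t) ≤ 1 := by
      rw [← Real.exp_add]
      exact Real.exp_le_one_iff.2 (by nlinarith)
    rw [abs_of_nonneg (by positivity)]
    have hm : Real.exp (-(l / 2 * t)) * Real.sinh (k * t) ≤ 1 / 2 := by
      nlinarith [Real.exp_pos (-(l / 2 * t)), mul_le_mul_of_nonneg_left hs (Real.exp_pos (-(l / 2 * t))).le]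
    rw [← mul_div_assoc, ← mul_div_assoc, div_le_iff₀ hk0]
    nlinarith
  · have h2 : l ≤ 3 * |q| := by
      refine abs_le_of_sq_le_sq' (a := l) (b := 3 * |q|) ?_ (by positivity) |>.2
      rw [mul_pow, sq_abs]
      nlinarith
    have := abs_mul_abs_oscillator_le hl q ht
    nlinarith [mul_le_mul_of_nonneg_right h2 (abs_nonneg (oscillator l q t))]

/-- Before the time scale `1 / l` an overdamped oscillator moves freely. -/
lemma le_oscillator_of_mul_le_one {l q t : ℝ} (ht : 0 ≤ t)
    (hD : 0 < l ^ 2 / 4 - q ^ 2) (hlt : l * t ≤ 1) : t / 2 ≤ oscillator l q t := by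
  rw [oscillator_eq_of_pos hD]
  set k := √(l ^ 2 / 4 - q ^ 2)
  have hk0 : 0 < k := Real.sqrt_pos.2 hD
  have hs : t ≤ Real.sinh (k * t) / k := by
    rw [le_div_iff₀ hk0, mul_comm]
    exact Real.self_le_sinh_iff.2 (by positivity)
  have he : 1 / 2 ≤ Real.exp (-(l / 2 * t)) := by
    linarith [Real.add_one_le_exp (-(l / 2 * t))]
  calc t / 2 = 1 / 2 * t := by ring
    _ ≤ _ := by gcongr

/-- Between the time scales `1 / l` and `l / q²` an overdamped oscillator stays near `1 / l`. -/
lemma le_oscillator_of_one_le_mul {l q t : ℝ} (hl : 0 < l) (ht : 0 ≤ t)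
    (hD : l ^ 2 / 16 ≤ l ^ 2 / 4 - q ^ 2) (hlt : 1 ≤ l * t) :
    Real.exp (-(2 * q ^ 2 / l * t)) / (3 * l) ≤ oscillator l q t := by
  have hD' : 0 < l ^ 2 / 4 - q ^ 2 := lt_of_lt_of_le (by positivity) hD
  have hk : l / 4 ≤ √(l ^ 2 / 4 - q ^ 2) := Real.le_sqrt_of_sq_le (by nlinarith)
  have hk' := sqrt_discriminant_le hl.le q
  have hksq : √(l ^ 2 / 4 - q ^ 2) ^ 2 = l ^ 2 / 4 - q ^ 2 := Real.sq_sqrt hD'.le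
  rw [oscillator_eq_of_pos hD']
  set k := √(l ^ 2 / 4 - q ^ 2)
  have hk0 : 0 < k := lt_of_lt_of_le (by positivity) hk
  have hkt : 1 / 4 ≤ k * t := by nlinarith
  -- Here `2kt ≥ 1/2`, and `exp (1/2) ≥ 3/2`; so the decaying half of `sinh` removes at most two
  -- thirds of the growing half.
  have h1 : Real.exp (-(2 * (k * t))) ≤ 2 / 3 := by
    rw [Real.exp_neg, inv_le_comm₀ (Real.exp_pos _) (by norm_num)]
    linarith [Real.add_one_le_exp (2 * (k * t))]
  have hsinh : Real.exp (k * t) * (1 / 6) ≤ Real.sinh (k * t) := by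
    have : Real.exp (-(k * t)) = Real.exp (k * t) * Real.exp (-(2 * (k * t))) := by
      rw [← Real.exp_add]; ring_nf
    rw [Real.sinh_eq, this]
    nlinarith [Real.exp_pos (k * t)]
  -- The slow decay rate: `(l/2 - k)(l/2 + k) = q²` gives `l/2 - k ≤ 2q² / l`.
  have hdecay : -(2 * q ^ 2 / l * t) ≤ -(l / 2 * t) + k * t := by
    have : l / 2 - k ≤ 2 * q ^ 2 / l := by
      rw [le_div_iff₀ hl]
      nlinarith
    nlinarith
  have hexp : Real.exp (-(2 * q ^ 2 / l * t)) ≤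
      Real.exp (-(l / 2 * t)) * Real.exp (k * t) := by
    rw [← Real.exp_add]
    exact Real.exp_le_exp.2 hdecay
  calc Real.exp (-(2 * q ^ 2 / l * t)) / (3 * l)
      ≤ Real.exp (-(l / 2 * t)) * Real.exp (k * t) / (3 * l) := by gcongr
    _ ≤ Real.exp (-(l / 2 * t)) * Real.exp (k * t) / (6 * k) :=
        div_le_div_of_nonneg_left (by positivity) (by positivity) (by linarith)
    _ = Real.exp (-(l / 2 * t)) * (Real.exp (k * t) * (1 / 6) / k) := by
        field_simp
    _ ≤ _ := by gcongr

/-- Taylor's estimate of first order on the half-line. -/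
lemma abs_sub_sub_mul_le {f f' f'' : ℝ → ℝ} {K : ℝ}
    (hf : ∀ s, HasDerivAt f (f' s) s) (hf' : ∀ s, HasDerivAt f' (f'' s) s)
    (hK : ∀ s, 0 ≤ s → |f'' s| ≤ K) {r s : ℝ} (hr : 0 ≤ r) (hs : 0 ≤ s) :
    |f s - f r - (s - r) * f' r| ≤ K * (s - r) ^ 2 := by
  have h1 : ∀ x ∈ uIcc r s, |f' x - f' r| ≤ K * |s - r| := fun x hx => by
    have hx0 : 0 ≤ x := le_trans (le_min hr hs) hx.1
    have := (convex_Ici (0 : ℝ)).norm_image_sub_le_of_norm_hasDerivWithin_le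
      (f := f') (C := K) (fun s _ => (hf' s).hasDerivWithinAt)
      (fun s hs => hK s hs) (mem_Ici.2 hr) (mem_Ici.2 hx0)
    refine this.trans ?_
    have hK0 : 0 ≤ K := (abs_nonneg _).trans (hK 0 le_rfl)
    gcongr
    exact abs_sub_left_of_mem_uIcc hx
  have h2 := (convex_uIcc r s).norm_image_sub_le_of_norm_hasDerivWithin_le
    (f := fun x => f x - x * f' r) (f' := fun x => f' x - f' r) (C := K * |s - r|)
    (fun x _ => ((hf x).sub (by simpa using (hasDerivAt_id x).mul_const (f' r))).hasDerivWithinAt)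
    h1 left_mem_uIcc right_mem_uIcc
  simp only [Real.norm_eq_abs] at h2
  rw [mul_assoc, ← pow_two, sq_abs] at h2
  convert h2 using 2
  ring

/-! ### Multiplication operators on `L²(ℝ)` -/

/-- A bounded measurable real multiplier. -/
def IsBoundedMultiplier (b : ℝ → ℝ) : Prop := Measurable b ∧ ∃ C, ∀ ξ, |b ξ| ≤ C

lemma memLp_ofReal_mul {b : ℝ → ℝ} (hb : IsBoundedMultiplier b) (g : L2) :
    MemLp (fun ξ => (b ξ : ℂ) * g ξ) 2 volume := by
  obtain ⟨hm, C, hC⟩ := hb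
  refine (Lp.memLp g).of_le_mul (c := C)
    ((Complex.measurable_ofReal.comp hm).aestronglyMeasurable.mul (Lp.aestronglyMeasurable g))
    (Eventually.of_forall fun ξ => ?_)
  rw [norm_mul, Complex.norm_real]
  exact mul_le_mul_of_nonneg_right (hC ξ) (norm_nonneg _)

open Classical in
/-- Multiplication by a bounded multiplier (the junk value is `0`). -/
noncomputable def mulL2 (b : ℝ → ℝ) (g : L2) : L2 :=
  if h : MemLp (fun ξ => (b ξ : ℂ) * g ξ) 2 volume then h.toLp _ else 0

lemma coeFn_mulL2 {b : ℝ → ℝ} (hb : IsBoundedMultiplier b) (g : L2) :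
    (mulL2 b g : ℝ → ℂ) =ᵐ[volume] fun ξ => (b ξ : ℂ) * g ξ := by
  have h := memLp_ofReal_mul hb g
  rw [mulL2, dif_pos h]
  exact h.coeFn_toLp

/-- A multiplier moves from one side of the inner product to the other. -/
lemma inner_eq_inner_of_ae_mul {b n : ℝ → ℝ} {g w x y d : L2}
    (hx : (x : ℝ → ℂ) =ᵐ[volume] fun ξ => (b ξ : ℂ) * g ξ)
    (hy : (y : ℝ → ℂ) =ᵐ[volume] fun ξ => ((n ξ * b ξ : ℝ) : ℂ) * g ξ)
    (hd : (d : ℝ → ℂ) =ᵐ[volume] fun ξ => (n ξ : ℂ) * w ξ) : ⟪x, d⟫_ℂ = ⟪y, w⟫_ℂ := by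
  rw [L2.inner_def, L2.inner_def]
  refine integral_congr_ae ?_
  filter_upwards [hx, hy, hd] with ξ h1 h2 h3
  simp only [RCLike.inner_apply, h1, h2, h3, map_mul, Complex.conj_ofReal]
  push_cast
  ring

/-- A family of multipliers that is twice differentiable in time, with uniformly bounded second
derivative, is differentiable as a family of operators applied to a fixed function. -/
lemma hasDerivWithinAt_mulL2 {F F' F'' : ℝ → ℝ → ℝ} {K : ℝ}
    (hF : ∀ ξ s, HasDerivAt (F ξ) (F' ξ s) s) (hF' : ∀ ξ s, HasDerivAt (F' ξ) (F'' ξ s) s)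
    (hK : ∀ ξ s, 0 ≤ s → |F'' ξ s| ≤ K)
    (hb : ∀ s, 0 ≤ s → IsBoundedMultiplier fun ξ => F ξ s)
    (hb' : ∀ s, 0 ≤ s → IsBoundedMultiplier fun ξ => F' ξ s) (g : L2) {r : ℝ} (hr : 0 ≤ r) :
    HasDerivWithinAt (fun s => mulL2 (fun ξ => F ξ s) g) (mulL2 (fun ξ => F' ξ r) g) (Ici 0) r := by
  -- The pointwise Taylor remainder is uniform in `ξ`, so it passes to the `L²` norm with the same
  -- quadratic order.
  have key : ∀ s ∈ Ici (0 : ℝ), ‖mulL2 (fun ξ => F ξ s) g - mulL2 (fun ξ => F ξ r) g -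
      (s - r) • mulL2 (fun ξ => F' ξ r) g‖ ≤ K * ‖g‖ * ‖(s - r) ^ 2‖ := fun s hs => by
    have hs : 0 ≤ s := hs
    have := Lp.norm_le_mul_norm_of_ae_le_mul (c := K * (s - r) ^ 2)
      (f := mulL2 (fun ξ => F ξ s) g - mulL2 (fun ξ => F ξ r) g -
        (s - r) • mulL2 (fun ξ => F' ξ r) g) (g := g) (by
      filter_upwards [coeFn_mulL2 (hb s hs) g, coeFn_mulL2 (hb r hr) g, coeFn_mulL2 (hb' r hr) g,
        Lp.coeFn_sub (mulL2 (fun ξ => F ξ s) g - mulL2 (fun ξ => F ξ r) g)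
          ((s - r) • mulL2 (fun ξ => F' ξ r) g),
        Lp.coeFn_sub (mulL2 (fun ξ => F ξ s) g) (mulL2 (fun ξ => F ξ r) g),
        Lp.coeFn_smul (s - r) (mulL2 (fun ξ => F' ξ r) g)] with ξ h1 h2 h3 h4 h5 h6
      rw [h4, Pi.sub_apply, h5, h6, Pi.sub_apply, Pi.smul_apply, h1, h2, h3, Complex.real_smul]
      have h7 : (F ξ s : ℂ) * g ξ - F ξ r * g ξ - ((s - r : ℝ) : ℂ) * (F' ξ r * g ξ) =
          ((F ξ s - F ξ r - (s - r) * F' ξ r : ℝ) : ℂ) * g ξ := by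
        push_cast; ring
      rw [h7, norm_mul, Complex.norm_real]
      exact mul_le_mul_of_nonneg_right
        (abs_sub_sub_mul_le (hF ξ) (hF' ξ) (hK ξ) hr hs) (norm_nonneg _))
    rw [Real.norm_of_nonneg (sq_nonneg _)]
    linarith
  rw [hasDerivWithinAt_iff_isLittleO]
  have h1 : (fun s => mulL2 (fun ξ => F ξ s) g - mulL2 (fun ξ => F ξ r) g -
      (s - r) • mulL2 (fun ξ => F' ξ r) g) =O[𝓝[Ici 0] r] fun s => (s - r) ^ 2 :=
    Asymptotics.IsBigO.of_bound (K * ‖g‖) (eventually_nhdsWithin_of_forall key)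
  refine h1.trans_isLittleO ?_
  have h2 : (fun s : ℝ => (s - r) ^ 2) =o[𝓝 r] fun s => s - r :=
    by simpa only [Real.norm_eq_abs, sq_abs] using Asymptotics.isLittleO_pow_sub_sub r one_lt_two
  exact h2.mono nhdsWithin_le_nhds

/-! ### Representation of solutions on the Fourier side -/

section Representation

variable {l q : ℝ → ℝ}

/-- The symbols are unbounded on the line; cutting off to `S` requires bounds only there, and makes
every multiplier of the duality argument a bounded operator. -/
lemma isBoundedMultiplier_indicator {S : Set ℝ} (hS : MeasurableSet S) {b : ℝ → ℝ}
    (hb : Measurable b) {C : ℝ} (hC : ∀ ξ ∈ S, |b ξ| ≤ C) :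
    IsBoundedMultiplier fun ξ => S.indicator 1 ξ * b ξ := by
  refine ⟨(measurable_one.indicator hS).mul hb, max C 0, fun ξ => ?_⟩
  by_cases h : ξ ∈ S
  · simpa [h] using Or.inl (hC ξ h)
  · simp [h]

/-- The Duhamel identity: on a set of frequencies on which the symbols are bounded, a solution of
the integrated equation is given by the oscillator. -/
lemma inner_indicator_eq_of_equation (hl : Measurable l) (hq : Measurable q) (hl0 : ∀ ξ, 0 ≤ l ξ)
    {S : Set ℝ} (hS : MeasurableSet S) {Λ Q : ℝ} (hΛ : ∀ ξ ∈ S, l ξ ≤ Λ) (hQ : ∀ ξ ∈ S, |q ξ| ≤ Q)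
    {f : L2} {U V W A B : ℝ → L2}
    (hU0 : U 0 = 0) (hW0 : W 0 = 0)
    (hU : ∀ t, 0 ≤ t → HasDerivWithinAt U (V t) (Ici 0) t)
    (hW : ∀ t, 0 ≤ t → HasDerivWithinAt W (U t) (Ici 0) t)
    (hA : ∀ t, 0 ≤ t → (A t : ℝ → ℂ) =ᵐ[volume] fun ξ => ((q ξ ^ 2 : ℝ) : ℂ) * W t ξ)
    (hB : ∀ t, 0 ≤ t → (B t : ℝ → ℂ) =ᵐ[volume] fun ξ => (l ξ : ℂ) * U t ξ)
    (hV : ∀ t, 0 ≤ t → V t = f - A t - B t) (g : L2) {t : ℝ} (ht : 0 ≤ t) :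
    ⟪mulL2 (S.indicator 1) g, U t⟫_ℂ =
      ⟪mulL2 (fun ξ => S.indicator 1 ξ * oscillator (l ξ) (q ξ) t) g, f⟫_ℂ := by
  classical
  set χ : ℝ → ℝ := S.indicator 1 with hχ
  set m : ℝ → ℝ → ℝ := fun ξ => oscillator (l ξ) (q ξ) with hm
  set m' : ℝ → ℝ → ℝ := fun ξ => oscillatorDeriv (l ξ) (q ξ) with hm'
  have hmd : ∀ ξ s, HasDerivAt (m ξ) (m' ξ s) s := fun ξ s => hasDerivAt_oscillator _ _ s
  have hmd' : ∀ ξ s, HasDerivAt (m' ξ) (-l ξ * m' ξ s - q ξ ^ 2 * m ξ s) s :=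
    fun ξ s => hasDerivAt_oscillatorDeriv _ _ s
  have hmM : ∀ s, Measurable fun ξ => m ξ s := fun s => measurable_oscillator hl hq s
  have hmM' : ∀ s, Measurable fun ξ => m' ξ s := fun s => measurable_oscillatorDeriv hl hq s
  have b0 : ∀ ξ s, 0 ≤ s → |m ξ s| ≤ s := fun ξ s hs => abs_oscillator_le (hl0 ξ) _ hs
  have b1 : ∀ ξ s, 0 ≤ s → |m' ξ s| ≤ 1 := fun ξ s hs => abs_oscillatorDeriv_le (hl0 ξ) _ hs
  have b2 : ∀ ξ ∈ S, ∀ s, 0 ≤ s → |q ξ ^ 2 * m ξ s| ≤ Q := fun ξ hξ s hs => by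
    have h := abs_mul_abs_oscillator_le (hl0 ξ) (q ξ) hs
    calc |q ξ ^ 2 * m ξ s| = |q ξ| * (|q ξ| * |m ξ s|) := by
          rw [abs_mul, abs_pow]; ring
      _ ≤ |q ξ| * 1 := by gcongr
      _ ≤ Q := by simpa using hQ ξ hξ
  have b3 : ∀ ξ ∈ S, ∀ s, 0 ≤ s → |l ξ * m' ξ s| ≤ Λ := fun ξ hξ s hs => by
    rw [abs_mul, abs_of_nonneg (hl0 ξ)]
    calc l ξ * |m' ξ s| ≤ l ξ * 1 := by
          have := b1 ξ s hs; have := hl0 ξ; gcongr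
      _ ≤ Λ := by simpa using hΛ ξ hξ
  have b4 : ∀ ξ ∈ S, ∀ s, 0 ≤ s → |-l ξ * m' ξ s - q ξ ^ 2 * m ξ s| ≤ Λ + Q := fun ξ hξ s hs => by
    refine (abs_sub _ _).trans (add_le_add ?_ (b2 ξ hξ s hs))
    rw [neg_mul, abs_neg]
    exact b3 ξ hξ s hs
  have b5 : ∀ ξ ∈ S, q ξ ^ 2 ≤ Q ^ 2 := fun ξ hξ => by
    rw [← sq_abs]; have := hQ ξ hξ; gcongr
  have b6 : ∀ ξ ∈ S, ∀ s, 0 ≤ s → |q ξ ^ 2 * m' ξ s| ≤ Q ^ 2 := fun ξ hξ s hs => by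
    rw [abs_mul, abs_of_nonneg (sq_nonneg _)]
    calc q ξ ^ 2 * |m' ξ s| ≤ Q ^ 2 * 1 := by
          have := b1 ξ s hs; have := b5 ξ hξ; gcongr
      _ = Q ^ 2 := mul_one _
  have hχm : ∀ {b : ℝ → ℝ} {C : ℝ}, (∀ ξ ∈ S, |b ξ| ≤ C) → ∀ ξ, |χ ξ * b ξ| ≤ max C 0 := by
    intro b C hb ξ
    by_cases h : ξ ∈ S
    · simpa [hχ, h] using Or.inl (hb ξ h)
    · simp [hχ, h]
  have B0 : ∀ s, 0 ≤ s → IsBoundedMultiplier fun ξ => χ ξ * m ξ s := fun s hs =>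
    isBoundedMultiplier_indicator hS (hmM s) fun ξ _ => b0 ξ s hs
  have B1 : ∀ s, 0 ≤ s → IsBoundedMultiplier fun ξ => χ ξ * m' ξ s := fun s hs =>
    isBoundedMultiplier_indicator hS (hmM' s) fun ξ _ => b1 ξ s hs
  have B2 : ∀ s, 0 ≤ s → IsBoundedMultiplier fun ξ => χ ξ * (-l ξ * m' ξ s - q ξ ^ 2 * m ξ s) :=
    fun s hs => isBoundedMultiplier_indicator hS
      ((hl.neg.mul (hmM' s)).sub ((hq.pow_const 2).mul (hmM s))) fun ξ hξ => b4 ξ hξ s hs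
  have BE0 : ∀ s, 0 ≤ s → IsBoundedMultiplier fun ξ => χ ξ * (q ξ ^ 2 * m ξ s) := fun s hs =>
    isBoundedMultiplier_indicator hS ((hq.pow_const 2).mul (hmM s)) fun ξ hξ => b2 ξ hξ s hs
  have BE1 : ∀ s, 0 ≤ s → IsBoundedMultiplier fun ξ => χ ξ * (q ξ ^ 2 * m' ξ s) := fun s hs =>
    isBoundedMultiplier_indicator hS ((hq.pow_const 2).mul (hmM' s)) fun ξ hξ => b6 ξ hξ s hs
  have BL : ∀ s, 0 ≤ s → IsBoundedMultiplier fun ξ => χ ξ * (l ξ * m' ξ s) := fun s hs =>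
    isBoundedMultiplier_indicator hS (hl.mul (hmM' s)) fun ξ hξ => b3 ξ hξ s hs
  -- All time regularity is put on the test side: `V` is not assumed differentiable and `U` need not
  -- lie in the domain of `q²`, while `F0` and `F1` are differentiable thanks to the cutoff.
  set F0 : ℝ → L2 := fun s => mulL2 (fun ξ => χ ξ * m ξ s) g with hF0
  set F1 : ℝ → L2 := fun s => mulL2 (fun ξ => χ ξ * m' ξ s) g with hF1
  set F2 : ℝ → L2 := fun s => mulL2 (fun ξ => χ ξ * (-l ξ * m' ξ s - q ξ ^ 2 * m ξ s)) g with hF2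
  set E0 : ℝ → L2 := fun s => mulL2 (fun ξ => χ ξ * (q ξ ^ 2 * m ξ s)) g with hE0
  set E1 : ℝ → L2 := fun s => mulL2 (fun ξ => χ ξ * (q ξ ^ 2 * m' ξ s)) g with hE1
  set FL : ℝ → L2 := fun s => mulL2 (fun ξ => χ ξ * (l ξ * m' ξ s)) g with hFL
  have dF0 : ∀ s, 0 ≤ s → HasDerivWithinAt F0 (F1 s) (Ici 0) s := fun s hs =>
    hasDerivWithinAt_mulL2 (K := max (Λ + Q) 0)
      (F := fun ξ s => χ ξ * m ξ s) (F' := fun ξ s => χ ξ * m' ξ s)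
      (fun ξ s => (hmd ξ s).const_mul _) (fun ξ s => (hmd' ξ s).const_mul _)
      (fun ξ s hs => hχm (fun ξ hξ => b4 ξ hξ s hs) ξ) B0 B1 g hs
  have dF1 : ∀ s, 0 ≤ s → HasDerivWithinAt F1 (F2 s) (Ici 0) s := fun s hs =>
    hasDerivWithinAt_mulL2 (K := max (Λ * (Λ + Q) + Q ^ 2) 0)
      (F := fun ξ s => χ ξ * m' ξ s) (F' := fun ξ s => χ ξ * (-l ξ * m' ξ s - q ξ ^ 2 * m ξ s))
      (F'' := fun ξ s => χ ξ * (-l ξ * (-l ξ * m' ξ s - q ξ ^ 2 * m ξ s) - q ξ ^ 2 * m' ξ s))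
      (fun ξ s => (hmd' ξ s).const_mul _)
      (fun ξ s => (((hmd' ξ s).const_mul _).sub ((hmd ξ s).const_mul _)).const_mul _)
      (fun ξ s hs => hχm (b := fun ξ => -l ξ * (-l ξ * m' ξ s - q ξ ^ 2 * m ξ s) - q ξ ^ 2 * m' ξ s)
        (fun ξ hξ => by
          refine (abs_sub _ _).trans (add_le_add ?_ (b6 ξ hξ s hs))
          rw [abs_mul, abs_neg, abs_of_nonneg (hl0 ξ)]
          have h1 := hΛ ξ hξ
          have h2 := b4 ξ hξ s hs
          have h3 := hl0 ξ
          have h4 : 0 ≤ Λ := h3.trans h1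
          gcongr) ξ) B1 B2 g hs
  have dE0 : ∀ s, 0 ≤ s → HasDerivWithinAt E0 (E1 s) (Ici 0) s := fun s hs =>
    hasDerivWithinAt_mulL2 (K := max (Q ^ 2 * (Λ + Q)) 0)
      (F := fun ξ s => χ ξ * (q ξ ^ 2 * m ξ s)) (F' := fun ξ s => χ ξ * (q ξ ^ 2 * m' ξ s))
      (F'' := fun ξ s => χ ξ * (q ξ ^ 2 * (-l ξ * m' ξ s - q ξ ^ 2 * m ξ s)))
      (fun ξ s => ((hmd ξ s).const_mul _).const_mul _)
      (fun ξ s => ((hmd' ξ s).const_mul _).const_mul _)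
      (fun ξ s hs => hχm (b := fun ξ => q ξ ^ 2 * (-l ξ * m' ξ s - q ξ ^ 2 * m ξ s))
        (fun ξ hξ => by
          rw [abs_mul, abs_of_nonneg (sq_nonneg _)]
          have h1 := b5 ξ hξ
          have h2 := b4 ξ hξ s hs
          gcongr) ξ) BE0 BE1 g hs
  have hF2eq : ∀ s, 0 ≤ s → F2 s = -FL s - E0 s := fun s hs => by
    refine Lp.ext ?_
    filter_upwards [coeFn_mulL2 (B2 s hs) g, coeFn_mulL2 (BL s hs) g, coeFn_mulL2 (BE0 s hs) g,
      Lp.coeFn_sub (-FL s) (E0 s), Lp.coeFn_neg (FL s)] with ξ h1 h2 h3 h4 h5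
    rw [h4, Pi.sub_apply, h5, Pi.neg_apply, h1, h2, h3]
    push_cast
    ring
  have hFB : ∀ r s, 0 ≤ r → 0 ≤ s → ⟪F1 r, B s⟫_ℂ = ⟪FL r, U s⟫_ℂ := fun r s hr hs =>
    inner_eq_inner_of_ae_mul (coeFn_mulL2 (B1 r hr) g)
      ((coeFn_mulL2 (BL r hr) g).trans (Eventually.of_forall fun ξ => by
        simp only; push_cast; ring)) (hB s hs)
  have hFA : ∀ r s, 0 ≤ r → 0 ≤ s → ⟪F1 r, A s⟫_ℂ = ⟪E1 r, W s⟫_ℂ := fun r s hr hs =>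
    inner_eq_inner_of_ae_mul (n := fun ξ => q ξ ^ 2) (coeFn_mulL2 (B1 r hr) g)
      ((coeFn_mulL2 (BE1 r hr) g).trans (Eventually.of_forall fun ξ => by
        simp only; push_cast; ring)) (hA s hs)
  -- the conserved quantity
  have hrev : ∀ {F F' : ℝ → L2}, (∀ s, 0 ≤ s → HasDerivWithinAt F (F' s) (Ici 0) s) →
      ∀ s ∈ Icc 0 t, HasDerivWithinAt (fun s => F (t - s)) (-F' (t - s)) (Icc 0 t) s := by
    intro F F' hF s hs
    have h1 : HasDerivWithinAt (fun s : ℝ => t - s) (-1) (Icc 0 t) s := by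
      simpa using ((hasDerivAt_id' s).const_sub t).hasDerivWithinAt
    have := HasDerivWithinAt.scomp (g₁ := F) (t' := Ici 0) s (hF (t - s) (by linarith [hs.2])) h1
      (fun x hx => by simpa using hx.2)
    exact this.congr_deriv (by simp)
  have hsub : ∀ {F F' : ℝ → L2}, (∀ s, 0 ≤ s → HasDerivWithinAt F (F' s) (Ici 0) s) →
      ∀ s ∈ Icc 0 t, HasDerivWithinAt F (F' s) (Icc 0 t) s := fun hF s hs =>
    (hF s hs.1).mono fun x hx => hx.1
  -- The solution runs forward and the oscillator backward from time `t`. In the derivative, the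
  -- terms in `f` cancel, those in `A` and `B` are moved to the test side by `hFA` and `hFB`, and
  -- the oscillator equation `hF2eq` cancels the rest. At `s = t` only the pairing with `U t`
  -- survives, at `s = 0` only the one with `f`.
  have hG : ∀ s ∈ Icc 0 t, HasDerivWithinAt
      (fun s => ⟪F1 (t - s), U s⟫_ℂ + ⟪F0 (t - s), f⟫_ℂ - ⟪E0 (t - s), W s⟫_ℂ) 0 (Icc 0 t) s := by
    intro s hs
    have hr : 0 ≤ t - s := by linarith [hs.2]
    refine ((((hrev dF1 s hs).inner ℂ (hsub hU s hs)).add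
      ((hrev dF0 s hs).inner ℂ (hasDerivWithinAt_const s _ f))).sub
      ((hrev dE0 s hs).inner ℂ (hsub hW s hs))).congr_deriv ?_
    rw [hF2eq _ hr, hV s hs.1]
    simp only [inner_sub_left, inner_sub_right, inner_neg_left, inner_zero_right,
      hFA _ s hr hs.1, hFB _ s hr hs.1]
    ring
  have hconst := constant_of_derivWithin_zero
    (fun s hs => (hG s hs).differentiableWithinAt)
    (fun s hs => (hG s (Ico_subset_Icc_self hs)).derivWithin
      (uniqueDiffOn_Icc (lt_of_le_of_lt hs.1 hs.2) s (Ico_subset_Icc_self hs))) t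
      ⟨ht, le_rfl⟩
  have hzero : mulL2 (fun _ => (0 : ℝ)) g = 0 := by
    refine Lp.ext ?_
    filter_upwards [coeFn_mulL2 (b := fun _ => (0 : ℝ)) ⟨measurable_const, 0, by simp⟩ g,
      Lp.coeFn_zero ℂ 2 (volume : Measure ℝ)] with ξ h1 h2
    rw [h1, h2]
    simp
  have e1 : F1 0 = mulL2 χ g := by simp [hF1, hm']
  have e2 : F0 0 = 0 := by simpa [hF0, hm] using hzero
  have e3 : E0 0 = 0 := by simpa [hE0, hm] using hzero
  simpa [e1, e2, e3, hU0, hW0] using hconst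

/-- The solution of the integrated equation on the Fourier side. -/
theorem ae_eq_oscillator_mul_of_equation (hl : Measurable l) (hq : Measurable q)
    (hl0 : ∀ ξ, 0 ≤ l ξ) (hlb : ∀ R : ℝ, ∃ Λ, ∀ ξ, |ξ| ≤ R → l ξ ≤ Λ)
    (hqb : ∀ R : ℝ, ∃ Q, ∀ ξ, |ξ| ≤ R → |q ξ| ≤ Q)
    {f : L2} {U V W A B : ℝ → L2}
    (hU0 : U 0 = 0) (hW0 : W 0 = 0)
    (hU : ∀ t, 0 ≤ t → HasDerivWithinAt U (V t) (Ici 0) t)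
    (hW : ∀ t, 0 ≤ t → HasDerivWithinAt W (U t) (Ici 0) t)
    (hA : ∀ t, 0 ≤ t → (A t : ℝ → ℂ) =ᵐ[volume] fun ξ => ((q ξ ^ 2 : ℝ) : ℂ) * W t ξ)
    (hB : ∀ t, 0 ≤ t → (B t : ℝ → ℂ) =ᵐ[volume] fun ξ => (l ξ : ℂ) * U t ξ)
    (hV : ∀ t, 0 ≤ t → V t = f - A t - B t) {t : ℝ} (ht : 0 ≤ t) :
    (U t : ℝ → ℂ) =ᵐ[volume] fun ξ => (oscillator (l ξ) (q ξ) t : ℂ) * f ξ := by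
  have hb : IsBoundedMultiplier fun ξ => oscillator (l ξ) (q ξ) t :=
    ⟨measurable_oscillator hl hq t, t, fun ξ => abs_oscillator_le (hl0 ξ) _ ht⟩
  set Y := mulL2 (fun ξ => oscillator (l ξ) (q ξ) t) f with hY
  have key : ∀ n : ℕ, ∀ᵐ ξ : ℝ ∂volume, |ξ| ≤ (n : ℝ) → U t ξ = Y ξ := by
    intro n
    obtain ⟨Λ, hΛ⟩ := hlb n
    obtain ⟨Q, hQ⟩ := hqb n
    have hS : MeasurableSet {ξ : ℝ | |ξ| ≤ n} := measurableSet_le (by fun_prop) (by fun_prop)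
    set S := {ξ : ℝ | |ξ| ≤ n} with hSdef
    set χ : ℝ → ℝ := S.indicator 1 with hχ
    have hχb : IsBoundedMultiplier χ := by
      simpa using isBoundedMultiplier_indicator hS (b := fun _ => 1) (C := 1) measurable_const
        (by simp)
    -- The duality identity is tested on the error `U t - Y` itself; since `χ² = χ`, this makes the
    -- norm of its restriction to `S` vanish.
    have h1 := inner_indicator_eq_of_equation hl hq hl0 hS hΛ hQ hU0 hW0 hU hW hA hB hV
      (U t - Y) ht
    have h2 : ⟪mulL2 χ (U t - Y), Y⟫_ℂ =
        ⟪mulL2 (fun ξ => χ ξ * oscillator (l ξ) (q ξ) t) (U t - Y), f⟫_ℂ :=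
      inner_eq_inner_of_ae_mul (coeFn_mulL2 hχb _)
        ((coeFn_mulL2 (isBoundedMultiplier_indicator hS hb.1
          fun ξ _ => abs_oscillator_le (hl0 ξ) _ ht) _).trans (Eventually.of_forall fun ξ => by
            simp only [← hχ]; rw [mul_comm (χ ξ)])) (coeFn_mulL2 hb f)
    have h3 : ⟪mulL2 χ (U t - Y), U t - Y⟫_ℂ = 0 := by
      rw [inner_sub_right, h1, h2, sub_self]
    have h4 : ⟪mulL2 χ (U t - Y), mulL2 χ (U t - Y)⟫_ℂ = ⟪mulL2 χ (U t - Y), U t - Y⟫_ℂ :=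
      inner_eq_inner_of_ae_mul (coeFn_mulL2 hχb _)
        ((coeFn_mulL2 hχb _).trans (Eventually.of_forall fun ξ => by
          by_cases h : ξ ∈ S <;> simp [hχ, h])) (coeFn_mulL2 hχb _)
    rw [h3, inner_self_eq_zero] at h4
    have h5 := coeFn_mulL2 hχb (U t - Y)
    rw [h4] at h5
    filter_upwards [h5, Lp.coeFn_zero ℂ 2 (volume : Measure ℝ), Lp.coeFn_sub (U t) Y]
      with ξ h6 h7 h8 hξ
    rw [h7, h8] at h6
    have h9 : χ ξ = 1 := by simp [hχ, hSdef, hξ]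
    rw [h9] at h6
    simp only [Pi.zero_apply, Complex.ofReal_one, Pi.sub_apply, one_mul] at h6
    exact (sub_eq_zero.1 h6.symm)
  filter_upwards [ae_all_iff.2 key, coeFn_mulL2 hb f] with ξ h1 h2
  obtain ⟨n, hn⟩ := exists_nat_ge |ξ|
  rw [h1 n hn, h2]

end Representation

/-! ### The mild solution on the Fourier side -/

lemma logSymbol_nonneg (θ ξ : ℝ) : 0 ≤ logSymbol θ ξ :=
  Real.log_nonneg (by linarith [Real.rpow_nonneg (abs_nonneg ξ) (2 * θ)])

lemma measurable_logSymbol (θ : ℝ) : Measurable (logSymbol θ) := by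
  unfold logSymbol
  fun_prop

lemma logSymbol_le_rpow (θ ξ : ℝ) : logSymbol θ ξ ≤ |ξ| ^ (2 * θ) := by
  have h : 0 ≤ |ξ| ^ (2 * θ) := Real.rpow_nonneg (abs_nonneg ξ) _
  unfold logSymbol
  linarith [Real.log_le_sub_one_of_pos (show 0 < 1 + |ξ| ^ (2 * θ) by linarith)]

lemma rpow_div_two_le_logSymbol {θ ξ : ℝ} (hθ : 0 ≤ θ) (hξ : |ξ| ≤ 1) :
    |ξ| ^ (2 * θ) / 2 ≤ logSymbol θ ξ := by
  have h : 0 ≤ |ξ| ^ (2 * θ) := Real.rpow_nonneg (abs_nonneg ξ) _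
  have h1 : |ξ| ^ (2 * θ) ≤ 1 := Real.rpow_le_one (abs_nonneg ξ) hξ (by positivity)
  have h2 : 0 < 1 + |ξ| ^ (2 * θ) := by linarith
  have h3 := Real.one_sub_inv_le_log_of_pos h2
  refine le_trans ?_ h3
  rw [le_sub_iff_add_le, ← le_sub_iff_add_le', inv_le_iff_one_le_mul₀ h2]
  nlinarith

/-- The fundamental theorem of calculus on the half-line, including its endpoint. -/
lemma hasDerivWithinAt_integral_of_continuousOn {E : Type*} [NormedAddCommGroup E]
    [NormedSpace ℝ E] [CompleteSpace E] {u : ℝ → E} (hu : ContinuousOn u (Ici 0)) {t : ℝ}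
    (ht : 0 ≤ t) :
    HasDerivWithinAt (fun t => ∫ s in (0 : ℝ)..t, u s) (u t) (Ici 0) t := by
  -- Extending `u` by its value at `0` to negative times gives a continuous function on the line
  -- with the same integrals for `t ≥ 0`.
  have hc : Continuous fun s => u (max s 0) :=
    hu.comp_continuous (by fun_prop) fun s => le_max_right s 0
  have h1 : HasDerivAt (fun t => ∫ s in (0 : ℝ)..t, u (max s 0)) (u (max t 0)) t :=
    hc.integral_hasStrictDerivAt 0 t |>.hasDerivAt
  rw [max_eq_left ht] at h1
  have heq : ∀ r, 0 ≤ r → ∫ s in (0 : ℝ)..r, u s = ∫ s in (0 : ℝ)..r, u (max s 0) := fun r hr =>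
    intervalIntegral.integral_congr fun s hs => by
      rw [uIcc_of_le hr] at hs
      simp only [max_eq_left hs.1]
  exact h1.hasDerivWithinAt.congr (fun r hr => heq r hr) (heq t ht)

/-- The Fourier transform of a mild solution with vanishing initial displacement. -/
theorem IsMildSolution.fourier_ae_eq {θ : ℝ} (hθ : 0 ≤ θ) {u₁ : L2} {u : ℝ → L2}
    (h : IsMildSolution θ 0 u₁ u) {t : ℝ} (ht : 0 ≤ t) :
    ((𝓕 (u t) : L2) : ℝ → ℂ) =ᵐ[volume] fun ξ =>
      (oscillator (logSymbol θ (2 * Real.pi * ξ)) (2 * Real.pi * ξ) t : ℂ) * (𝓕 u₁ : L2) ξ := by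
  obtain ⟨h0, ⟨hc, -⟩, v, -, hv, heq⟩ := h
  choose a hmem hlap hveq using heq
  let Φ : L2 →L[ℝ] L2 :=
    ((Lp.fourierTransformₗᵢ ℝ ℂ).toContinuousLinearEquiv : L2 →L[ℂ] L2).restrictScalars ℝ
  have hΦ : ∀ x, Φ x = 𝓕 x := fun x => rfl
  classical
  refine ae_eq_oscillator_mul_of_equation
    (l := fun ξ => logSymbol θ (2 * Real.pi * ξ)) (q := fun ξ => 2 * Real.pi * ξ)
    (U := fun s => Φ (u s)) (V := fun s => Φ (v s)) (W := fun s => Φ (∫ r in (0 : ℝ)..s, u r))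
    -- `a` and the domain membership exist only for `s ≥ 0`; the value `0` at negative times is
    -- never used. The minus sign turns the symbol `-q²` of the Laplacian into `q²`.
    (A := fun s => if hs : 0 ≤ s then -Φ (a s hs) else 0)
    (B := fun s => if hs : 0 ≤ s then Φ (logDamping θ ⟨u s - 0, hmem s hs⟩) else 0)
    ((measurable_logSymbol θ).comp (by fun_prop)) (by fun_prop) (fun ξ => logSymbol_nonneg _ _)
    ?_ ?_ ?_ ?_ ?_ ?_ ?_ ?_ ?_ ht
  · intro R
    refine ⟨(2 * Real.pi * R) ^ (2 * θ), fun ξ hξ => (logSymbol_le_rpow _ _).trans ?_⟩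
    refine Real.rpow_le_rpow (abs_nonneg _) ?_ (by positivity)
    rw [abs_mul, abs_of_pos (by positivity : 0 < 2 * Real.pi)]
    gcongr
  · intro R
    refine ⟨2 * Real.pi * R, fun ξ hξ => ?_⟩
    rw [abs_mul, abs_of_pos (by positivity : 0 < 2 * Real.pi)]
    gcongr
  · simp [h0]
  · simp
  · intro s hs
    exact Φ.hasFDerivAt.comp_hasDerivWithinAt s (hv s hs)
  · intro s hs
    exact Φ.hasFDerivAt.comp_hasDerivWithinAt s (hasDerivWithinAt_integral_of_continuousOn hc hs)
  · intro s hs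
    simp only [hs, dif_pos, hΦ]
    filter_upwards [(hlap s hs).fourier_ae_eq, Lp.coeFn_neg (𝓕 (a s hs) : L2)] with ξ h1 h2
    rw [h2, Pi.neg_apply, h1]
    ring
  · intro s hs
    simp only [hs, dif_pos, hΦ]
    have h1 : (𝓕 (logDamping θ ⟨u s - 0, hmem s hs⟩) : L2) =
        MemLp.toLp (logMul θ (u s - 0)) (hmem s hs) :=
      FourierTransform.fourier_fourierInv_eq _
    rw [h1]
    refine (MemLp.coeFn_toLp _).trans ?_
    rw [sub_zero]
    rfl
  · intro s hs
    simp only [hs, dif_pos]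
    rw [hveq s hs, map_sub, map_add, hΦ u₁]
    abel

/-! ### Norm estimates on the Fourier side -/

lemma integrable_norm_sq (F : L2) : Integrable fun ξ => ‖F ξ‖ ^ 2 :=
  (memLp_two_iff_integrable_sq_norm (Lp.aestronglyMeasurable F)).1 (Lp.memLp F)

lemma norm_sq_eq_integral (F : L2) : ‖F‖ ^ 2 = ∫ ξ, ‖F ξ‖ ^ 2 := by
  have h := inner_self_eq_norm_sq_to_K (𝕜 := ℂ) F
  rw [L2.inner_def] at h
  simp only [inner_self_eq_norm_sq_to_K] at h
  have h2 : ((∫ ξ, ‖F ξ‖ ^ 2 : ℝ) : ℂ) = ((‖F‖ ^ 2 : ℝ) : ℂ) := by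
    rw [← integral_complex_ofReal]
    push_cast
    exact h
  exact_mod_cast h2.symm

lemma norm_sq_le_integral {F : L2} {φ : ℝ → ℝ} (hφ : Integrable φ)
    (h : ∀ᵐ ξ ∂volume, ‖F ξ‖ ^ 2 ≤ φ ξ) : ‖F‖ ^ 2 ≤ ∫ ξ, φ ξ := by
  rw [norm_sq_eq_integral]
  exact integral_mono_ae (integrable_norm_sq F) hφ h

lemma setIntegral_le_norm_sq {F : L2} {φ : ℝ → ℝ} {S : Set ℝ} (hS : MeasurableSet S)
    (hφ : IntegrableOn φ S) (h : ∀ᵐ ξ ∂volume, ξ ∈ S → φ ξ ≤ ‖F ξ‖ ^ 2) :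
    ∫ ξ in S, φ ξ ≤ ‖F‖ ^ 2 := by
  rw [norm_sq_eq_integral]
  refine (setIntegral_mono_on_ae hφ (integrable_norm_sq F).integrableOn hS h).trans ?_
  exact setIntegral_le_integral (integrable_norm_sq F) (Eventually.of_forall fun ξ => by positivity)

lemma integrable_comp_abs {f : ℝ → ℝ} (hf : IntegrableOn f (Ioi 0)) :
    Integrable fun x => f |x| := by
  have h1 : IntegrableOn (fun x => f |x|) (Ioi 0) :=
    hf.congr_fun (fun x hx => by simp only [abs_of_pos (show 0 < x from hx)]) measurableSet_Ioi
  have h2 : IntegrableOn (fun x => f |x|) (Iic 0) := by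
    rw [← Measure.map_neg_eq_self (volume : Measure ℝ)]
    let m : MeasurableEmbedding fun x : ℝ => -x := (Homeomorph.neg ℝ).measurableEmbedding
    rw [m.integrableOn_map_iff]
    simp_rw [Function.comp_def, abs_neg, neg_preimage, neg_Iic, neg_zero]
    exact Iff.mpr integrableOn_Ici_iff_integrableOn_Ioi h1
  rw [← integrableOn_univ, ← Iic_union_Ioi (a := (0 : ℝ))]
  exact h2.union h1

/-- A majorant, as a function of `|η|`, of the square of the oscillator with symbols
`log (1 + |η|^{2θ})` and `η`. -/
noncomputable def majorant (θ t x : ℝ) : ℝ :=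
  if x ≤ t ^ (-(1 / (2 * θ))) then t ^ 2 else if x ≤ 1 then 36 * x ^ (-(4 * θ)) else x ^ (-2 : ℝ)

/-- The three ranges use the three a priori bounds: `m ≤ t` from the velocity, `l m ≤ 3` from the
damping with `l ≥ |η|^{2θ} / 2` (whence `36 = 6²`), and `|η| m ≤ 1` from the energy. -/
lemma oscillator_sq_le_majorant {θ t : ℝ} (hθ : 0 ≤ θ) (ht : 0 ≤ t) (η : ℝ) :
    oscillator (logSymbol θ η) η t ^ 2 ≤ majorant θ t |η| := by
  have hl := logSymbol_nonneg θ η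
  rw [← sq_abs]
  unfold majorant
  have hrho : 0 ≤ t ^ (-(1 / (2 * θ))) := Real.rpow_nonneg ht _
  split_ifs with h1 h2
  · have := abs_oscillator_le hl η ht
    gcongr
  · have hη : 0 < |η| := lt_of_le_of_lt hrho (not_le.1 h1)
    have h3 := mul_abs_oscillator_le hl η ht
    have h4 := rpow_div_two_le_logSymbol hθ h2
    have hp : 0 < |η| ^ (2 * θ) := Real.rpow_pos_of_pos hη _
    have h5 : |oscillator (logSymbol θ η) η t| ≤ 6 * |η| ^ (-(2 * θ)) := by
      rw [Real.rpow_neg hη.le, ← div_eq_mul_inv, le_div_iff₀ hp]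
      nlinarith [mul_le_mul_of_nonneg_right h4 (abs_nonneg (oscillator (logSymbol θ η) η t))]
    calc |oscillator (logSymbol θ η) η t| ^ 2 ≤ (6 * |η| ^ (-(2 * θ))) ^ 2 := by gcongr
      _ = 36 * |η| ^ (-(4 * θ)) := by
        rw [mul_pow, ← Real.rpow_mul_natCast hη.le]
        norm_num
        ring_nf
  · have hη : 0 < |η| := lt_trans one_pos (not_le.1 h2)
    have h3 := abs_mul_abs_oscillator_le hl η ht
    have h5 : |oscillator (logSymbol θ η) η t| ≤ |η|⁻¹ := by
      rw [← one_div, le_div_iff₀ hη]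
      linarith
    calc |oscillator (logSymbol θ η) η t| ^ 2 ≤ (|η|⁻¹) ^ 2 := by gcongr
      _ = |η| ^ (-2 : ℝ) := by
        rw [Real.rpow_neg hη.le, inv_pow]
        norm_cast

lemma majorant_integral {θ t : ℝ} (hθ : 0 < θ) (ht : 1 ≤ t) :
    IntegrableOn (majorant θ t) (Ioi 0) ∧
      ∫ x in Ioi 0, majorant θ t x = t ^ 2 * t ^ (-(1 / (2 * θ))) +
        36 * (∫ x in t ^ (-(1 / (2 * θ)))..1, x ^ (-(4 * θ))) + 1 := by
  have ht0 : 0 < t := by linarith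
  have hr0 : 0 < t ^ (-(1 / (2 * θ))) := Real.rpow_pos_of_pos ht0 _
  have hr1 : t ^ (-(1 / (2 * θ))) ≤ 1 :=
    Real.rpow_le_one_of_one_le_of_nonpos ht (by simp [hθ.le])
  set ρ := t ^ (-(1 / (2 * θ))) with hρ
  have e1 : EqOn (fun _ => t ^ 2) (majorant θ t) (Ioc 0 ρ) := fun x hx => by
    simp only [majorant, ← hρ, hx.2, if_true]
  have e2 : EqOn (fun x => 36 * x ^ (-(4 * θ))) (majorant θ t) (Ioc ρ 1) := fun x hx => by
    simp only [majorant, ← hρ, not_le.2 hx.1, hx.2, if_true, if_false]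
  have e3 : EqOn (fun x => x ^ (-2 : ℝ)) (majorant θ t) (Ioi 1) := fun x hx => by
    have hx' : ¬ x ≤ 1 := not_le.2 hx
    have hx'' : ¬ x ≤ ρ := fun h => hx' (h.trans hr1)
    simp only [majorant, ← hρ, hx', hx'', if_false]
  have hii : IntervalIntegrable (fun x : ℝ => 36 * x ^ (-(4 * θ))) volume ρ 1 :=
    (intervalIntegral.intervalIntegrable_rpow
      (Or.inr (notMem_uIcc_of_lt hr0 one_pos))).const_mul 36
  have i1 : IntegrableOn (majorant θ t) (Ioc 0 ρ) :=
    (integrableOn_const (by simp)).congr_fun e1 measurableSet_Ioc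
  have i2 : IntegrableOn (majorant θ t) (Ioc ρ 1) :=
    ((intervalIntegrable_iff_integrableOn_Ioc_of_le hr1).1 hii).congr_fun e2 measurableSet_Ioc
  have i3 : IntegrableOn (majorant θ t) (Ioi 1) :=
    (integrableOn_Ioi_rpow_of_lt (by norm_num) one_pos).congr_fun e3 measurableSet_Ioi
  have v1 : ∫ x in Ioc 0 ρ, majorant θ t x = t ^ 2 * ρ := by
    rw [← setIntegral_congr_fun measurableSet_Ioc e1]
    simp [hr0.le, mul_comm]
  have v2 : ∫ x in Ioc ρ 1, majorant θ t x = 36 * ∫ x in ρ..1, x ^ (-(4 * θ)) := by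
    rw [← setIntegral_congr_fun measurableSet_Ioc e2, intervalIntegral.integral_of_le hr1,
      integral_const_mul]
  have v3 : ∫ x in Ioi 1, majorant θ t x = 1 := by
    rw [← setIntegral_congr_fun measurableSet_Ioi e3, integral_Ioi_rpow_of_lt (by norm_num) one_pos]
    norm_num
  have u1 : Ioc 0 ρ ∪ Ioi ρ = Ioi 0 := Ioc_union_Ioi_eq_Ioi hr0.le
  have u2 : Ioc ρ 1 ∪ Ioi 1 = Ioi ρ := Ioc_union_Ioi_eq_Ioi hr1
  have i4 : IntegrableOn (majorant θ t) (Ioi ρ) := u2 ▸ i2.union i3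
  refine ⟨u1 ▸ i1.union i4, ?_⟩
  rw [← u1, setIntegral_union (Ioc_disjoint_Ioi le_rfl) measurableSet_Ioi i1 i4, ← u2,
    setIntegral_union (Ioc_disjoint_Ioi le_rfl) measurableSet_Ioi i2 i3, v1, v2, v3]
  ring

lemma norm_fourier_le_weightedL1Norm {γ : ℝ} {u₁ : L2} (hu : MemWeightedL1 γ u₁) :
    ∀ᵐ ξ ∂volume, ‖(𝓕 u₁ : L2) ξ‖ ≤ weightedL1Norm γ u₁ := by
  filter_upwards [fourier_ae_eq_integral u₁ hu.1] with ξ hξ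
  rw [hξ]
  refine (norm_fourier_integral_le _ ξ).trans (integral_mono hu.1.norm hu.2 fun x => ?_)
  have h : 0 ≤ |x| ^ γ := Real.rpow_nonneg (abs_nonneg x) γ
  simp only
  nlinarith [norm_nonneg (u₁ x)]

lemma weightedL1Norm_nonneg (γ : ℝ) (f : ℝ → ℂ) : 0 ≤ weightedL1Norm γ f :=
  integral_nonneg fun x => by
    have h : 0 ≤ |x| ^ γ := Real.rpow_nonneg (abs_nonneg x) γ
    positivity

/-- The norm of a mild solution is controlled by the integral of the majorant. -/
lemma IsMildSolution.norm_sq_le {θ : ℝ} (hθ : 0 < θ) {u₁ : L2} {u : ℝ → L2}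
    (hu : MemWeightedL1 (2 * θ) u₁) (h : IsMildSolution θ 0 u₁ u) {t : ℝ} (ht : 1 ≤ t) :
    ‖u t‖ ^ 2 ≤ weightedL1Norm (2 * θ) u₁ ^ 2 * (t ^ 2 * t ^ (-(1 / (2 * θ))) +
        36 * (∫ x in t ^ (-(1 / (2 * θ)))..1, x ^ (-(4 * θ))) + 1) := by
  have ht0 : 0 ≤ t := by linarith
  obtain ⟨hint, hval⟩ := majorant_integral hθ ht
  have hpi : 2 * Real.pi ≠ 0 := by positivity
  rw [← Lp.norm_fourier_eq]
  have hN := weightedL1Norm_nonneg (2 * θ) u₁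
  set N := weightedL1Norm (2 * θ) u₁ with hNdef
  have hφ : Integrable fun ξ => N ^ 2 * majorant θ t |2 * Real.pi * ξ| :=
    ((integrable_comp_abs hint).comp_mul_left' hpi).const_mul _
  refine (norm_sq_le_integral hφ ?_).trans ?_
  · filter_upwards [h.fourier_ae_eq hθ.le ht0, norm_fourier_le_weightedL1Norm hu] with ξ h1 h2
    rw [h1, norm_mul, Complex.norm_real, mul_pow, Real.norm_eq_abs, sq_abs, mul_comm]
    have h3 := oscillator_sq_le_majorant hθ.le ht0 (2 * Real.pi * ξ)
    gcongr
  · have hnn : 0 ≤ ∫ x in Ioi 0, majorant θ t x := setIntegral_nonneg measurableSet_Ioi fun x hx => by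
      have hx : 0 < x := hx
      unfold majorant
      split_ifs <;> positivity
    rw [integral_const_mul, Measure.integral_comp_mul_left (fun x => majorant θ t |x|),
      integral_comp_abs (f := majorant θ t), smul_eq_mul, ← hval]
    gcongr
    rw [← mul_assoc, abs_of_pos (by positivity)]
    -- The Jacobian of `η = 2πξ` and the factor `2` from evenness together are at most `1` and are
    -- dropped.
    have : (2 * Real.pi)⁻¹ * 2 ≤ 1 := by
      rw [inv_mul_le_iff₀ (by positivity)]
      linarith [Real.pi_gt_three]
    nlinarith

lemma sq_mul_rpow_eq {θ t : ℝ} (hθ : 0 < θ) (ht : 0 < t) :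
    t ^ 2 * t ^ (-(1 / (2 * θ))) = (t ^ ((4 * θ - 1) / (4 * θ))) ^ 2 := by
  rw [← Real.rpow_natCast t 2, ← Real.rpow_add ht, ← Real.rpow_mul_natCast ht.le]
  congr 1
  field_simp
  push_cast
  ring

/-- For `4θ > 1` the integral of `x^{-4θ}` is governed by its lower limit `ρ`, and `ρ^{1-4θ}` is
again the square of the claimed rate; the constant `1` from high frequencies is absorbed because
that rate is at least `1`. -/
theorem IsMildSolution.norm_le_rpow {θ : ℝ} (hθ : 1 / 4 < θ) {u₁ : L2} {u : ℝ → L2}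
    (hu : MemWeightedL1 (2 * θ) u₁) (h : IsMildSolution θ 0 u₁ u) {t : ℝ} (ht : 1 ≤ t) :
    ‖u t‖ ≤ √(2 + 36 / (4 * θ - 1)) * weightedL1Norm (2 * θ) u₁ *
      t ^ ((4 * θ - 1) / (4 * θ)) := by
  have hθ0 : 0 < θ := by linarith
  have ht0 : 0 < t := by linarith
  have h4 : 0 < 4 * θ - 1 := by linarith
  have hρ : 0 < t ^ (-(1 / (2 * θ))) := Real.rpow_pos_of_pos ht0 _
  have h1 := h.norm_sq_le hθ0 hu ht
  have hN := weightedL1Norm_nonneg (2 * θ) u₁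
  have hI : ∫ x in t ^ (-(1 / (2 * θ)))..1, x ^ (-(4 * θ)) ≤
      (t ^ ((4 * θ - 1) / (4 * θ))) ^ 2 / (4 * θ - 1) := by
    rw [integral_rpow (Or.inr ⟨by linarith, notMem_uIcc_of_lt hρ one_pos⟩), Real.one_rpow,
      ← Real.rpow_mul ht0.le, ← neg_div_neg_eq]
    have e1 : -(-(4 * θ) + 1) = 4 * θ - 1 := by ring
    have e2 : t ^ (-(1 / (2 * θ)) * (-(4 * θ) + 1)) = (t ^ ((4 * θ - 1) / (4 * θ))) ^ 2 := by
      rw [← Real.rpow_mul_natCast ht0.le]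
      congr 1
      field_simp
      push_cast
      ring
    rw [e1, e2]
    gcongr
    linarith
  have hE : 1 ≤ t ^ ((4 * θ - 1) / (4 * θ)) := Real.one_le_rpow ht (by positivity)
  rw [sq_mul_rpow_eq hθ0 ht0] at h1
  set E := t ^ ((4 * θ - 1) / (4 * θ))
  set N := weightedL1Norm (2 * θ) u₁
  refine abs_le_of_sq_le_sq' (a := ‖u t‖) ?_ (by positivity) |>.2
  rw [mul_pow, mul_pow, Real.sq_sqrt (by positivity)]
  refine h1.trans ?_
  have hE2 : 1 ≤ E ^ 2 := one_le_pow₀ hE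
  calc N ^ 2 * (E ^ 2 + 36 * (∫ x in t ^ (-(1 / (2 * θ)))..1, x ^ (-(4 * θ))) + 1)
      ≤ N ^ 2 * (E ^ 2 + 36 * (E ^ 2 / (4 * θ - 1)) + E ^ 2) := by gcongr
    _ = _ := by ring

/-- At `θ = 1/4`, `ρ = t⁻²`, so the three ranges give `1 + 72 log t + 1`, at most `74 log t` once
`log t ≥ 1`. -/
theorem IsMildSolution.norm_le_sqrt_log {u₁ : L2} {u : ℝ → L2}
    (hu : MemWeightedL1 (2 * (1 / 4)) u₁) (h : IsMildSolution (1 / 4) 0 u₁ u) {t : ℝ}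
    (ht : 3 ≤ t) :
    ‖u t‖ ≤ √74 * weightedL1Norm (2 * (1 / 4)) u₁ * √(Real.log t) := by
  have ht0 : 0 < t := by linarith
  have h1 := h.norm_sq_le (by norm_num) hu (by linarith)
  have hN := weightedL1Norm_nonneg (2 * (1 / 4)) u₁
  set N := weightedL1Norm (2 * (1 / 4)) u₁
  have hlog : 1 ≤ Real.log t := by
    rw [Real.le_log_iff_exp_le ht0]
    linarith [Real.exp_one_lt_three]
  have e1 : t ^ (-(1 / (2 * (1 / 4 : ℝ)))) = (t ^ 2)⁻¹ := by
    rw [Real.rpow_neg ht0.le]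
    norm_num
  have e2 : ∫ x in (t ^ 2)⁻¹..1, x ^ (-(4 * (1 / 4 : ℝ))) = 2 * Real.log t := by
    have : ∀ x : ℝ, x ^ (-(4 * (1 / 4 : ℝ))) = x⁻¹ := fun x => by
      rw [show -(4 * (1 / 4 : ℝ)) = -1 by norm_num, Real.rpow_neg_one]
    simp only [this]
    rw [integral_inv_of_pos (by positivity) one_pos]
    simp
  rw [e1, e2, mul_inv_cancel₀ (by positivity)] at h1
  refine abs_le_of_sq_le_sq' (a := ‖u t‖) ?_ (by positivity) |>.2
  rw [mul_pow, mul_pow, Real.sq_sqrt (by positivity), Real.sq_sqrt (by positivity)]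
  refine h1.trans ?_
  nlinarith [sq_nonneg N]

/-! ### Lower bounds -/

lemma exists_half_norm_moment_le_fourier {u₁ : L2} (hu : Integrable u₁) :
    ∃ δ > 0, ∀ᵐ ξ ∂volume, |ξ| ≤ δ → ‖moment u₁‖ / 2 ≤ ‖(𝓕 u₁ : L2) ξ‖ := by
  have hc := (continuous_fourier_integral hu).norm.continuousAt (x := 0)
  rw [ContinuousAt, fourier_integral_zero] at hc
  -- A vanishing moment is treated apart, since continuity gives a neighbourhood only from the
  -- strict inequality `|P₁| / 2 < |P₁|`.
  rcases (norm_nonneg (moment u₁)).eq_or_lt with h0 | h0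
  · refine ⟨1, one_pos, Eventually.of_forall fun ξ _ => ?_⟩
    rw [← h0]
    simp
  have h1 := hc.eventually (lt_mem_nhds (half_lt_self h0))
  obtain ⟨δ, hδ, hball⟩ := Metric.eventually_nhds_iff.1 h1
  refine ⟨δ / 2, by positivity, ?_⟩
  filter_upwards [fourier_ae_eq_integral u₁ hu] with ξ hξ hξδ
  rw [hξ]
  exact (hball (by rw [Real.dist_eq, sub_zero]; linarith)).le

/-- At low frequencies the oscillator is overdamped. -/
lemma discriminant_ge {θ η : ℝ} (hθ : 0 ≤ θ) (hθ' : θ ≤ 1 / 3) (h0 : 0 < η) (h1 : η ≤ 1 / 512) :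
    logSymbol θ η ^ 2 / 16 ≤ logSymbol θ η ^ 2 / 4 - η ^ 2 := by
  have hη : |η| = η := abs_of_pos h0
  have h2 := rpow_div_two_le_logSymbol (ξ := η) hθ (by rw [hη]; linarith)
  rw [hη] at h2
  have h3 : 0 ≤ η ^ (2 * θ) := Real.rpow_nonneg h0.le _
  have h4 : η ≤ η ^ (2 * θ) / 8 := by
    -- The threshold `1/512 = 8⁻³` is chosen for this. As `2θ ≤ 2/3`, it yields `η ≤ η^{2θ} / 8 ≤ l
    -- / 4`, which is more than the discriminant bound needs.
    have h5 : η ^ (1 / 3 : ℝ) ≤ 1 / 8 := by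
      calc η ^ (1 / 3 : ℝ) ≤ (1 / 512) ^ (1 / 3 : ℝ) := by gcongr
        _ = ((1 / 8 : ℝ) ^ (3 : ℝ)) ^ (1 / 3 : ℝ) := by norm_num
        _ = 1 / 8 := by rw [← Real.rpow_mul (by norm_num)]; norm_num
    calc η = η ^ (2 / 3 : ℝ) * η ^ (1 / 3 : ℝ) := by
          rw [← Real.rpow_add h0]; norm_num
      _ ≤ η ^ (2 * θ) * (1 / 8) := by
          gcongr ?_ * ?_
          exact Real.rpow_le_rpow_of_exponent_ge h0 (by linarith) (by linarith)
      _ = _ := by ring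
  nlinarith

lemma logSymbol_pos {θ ξ : ℝ} (hξ : ξ ≠ 0) : 0 < logSymbol θ ξ :=
  Real.log_pos (by linarith [Real.rpow_pos_of_pos (abs_pos.2 hξ) (2 * θ)])

/-- A lower bound of the norm of a mild solution from a lower bound of the oscillator on an
interval of low frequencies. -/
lemma IsMildSolution.setIntegral_le_norm_sq {θ : ℝ} (hθ : 0 ≤ θ) {u₁ : L2} {u : ℝ → L2}
    (h : IsMildSolution θ 0 u₁ u) {δ : ℝ}
    (hδ : ∀ᵐ ξ ∂volume, |ξ| ≤ δ → ‖moment u₁‖ / 2 ≤ ‖(𝓕 u₁ : L2) ξ‖)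
    {t : ℝ} (ht : 0 ≤ t) {a b : ℝ} (ha : 0 ≤ a) (hb : b ≤ δ) {φ : ℝ → ℝ}
    (hφi : IntegrableOn φ (Ioc a b))
    (hφ : ∀ ξ ∈ Ioc a b,
      φ ξ ≤ oscillator (logSymbol θ (2 * Real.pi * ξ)) (2 * Real.pi * ξ) t ^ 2) :
    (‖moment u₁‖ / 2) ^ 2 * ∫ ξ in Ioc a b, φ ξ ≤ ‖u t‖ ^ 2 := by
  rw [← Lp.norm_fourier_eq, ← integral_const_mul]
  refine LogDampedWave.setIntegral_le_norm_sq measurableSet_Ioc (hφi.const_mul _) ?_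
  filter_upwards [h.fourier_ae_eq hθ ht, hδ] with ξ h1 h2 hξ
  have h3 := h2 (by rw [abs_of_pos (lt_of_le_of_lt ha hξ.1)]; exact hξ.2.trans hb)
  have h4 := hφ ξ hξ
  rw [h1, norm_mul, Complex.norm_real, mul_pow, Real.norm_eq_abs, sq_abs,
    mul_comm (oscillator _ _ _ ^ 2)]
  calc (‖moment u₁‖ / 2) ^ 2 * φ ξ
      ≤ (‖moment u₁‖ / 2) ^ 2 *
        oscillator (logSymbol θ (2 * Real.pi * ξ)) (2 * Real.pi * ξ) t ^ 2 := by gcongr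
    _ ≤ _ := by gcongr

/-- The frequencies `0 < η ≤ ρ` suffice: there `l t ≤ η^{2θ} t ≤ 1`, so the oscillator is at least
`t / 2`. -/
theorem IsMildSolution.rpow_le_norm {θ : ℝ} (hθ : 0 < θ) (hθ' : θ ≤ 1 / 3) {u₁ : L2} {u : ℝ → L2}
    (hu : Integrable u₁) (h : IsMildSolution θ 0 u₁ u) :
    ∀ᶠ t : ℝ in atTop,
      1 / 16 * ‖moment u₁‖ * t ^ ((4 * θ - 1) / (4 * θ)) ≤ ‖u t‖ := by
  obtain ⟨δ, hδ0, hδ⟩ := exists_half_norm_moment_le_fourier hu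
  have hρ : Tendsto (fun t : ℝ => t ^ (-(1 / (2 * θ)))) atTop (𝓝 0) :=
    tendsto_rpow_neg_atTop (by positivity)
  have hev := hρ.eventually (ge_mem_nhds (lt_min hδ0 (show (0 : ℝ) < 1 / 512 by norm_num)))
  filter_upwards [hev, eventually_gt_atTop 0] with t h1 ht
  have hpi : 0 < 2 * Real.pi := by positivity
  have hρ0 : 0 < t ^ (-(1 / (2 * θ))) := Real.rpow_pos_of_pos ht _
  have hsq := sq_mul_rpow_eq hθ ht
  have hρt : (t ^ (-(1 / (2 * θ)))) ^ (2 * θ) * t = 1 := by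
    rw [← Real.rpow_mul ht.le, show -(1 / (2 * θ)) * (2 * θ) = -1 by field_simp,
      Real.rpow_neg_one, inv_mul_cancel₀ ht.ne']
  set ρ := t ^ (-(1 / (2 * θ)))
  set E := t ^ ((4 * θ - 1) / (4 * θ)) with hE
  have hE0 : 0 ≤ E := Real.rpow_nonneg ht.le _
  have key := h.setIntegral_le_norm_sq hθ.le hδ ht.le (a := 0) (b := ρ / (2 * Real.pi))
    (φ := fun _ => (t / 2) ^ 2) le_rfl (by
      rw [div_le_iff₀ hpi]
      have := h1.trans (min_le_left _ _)
      nlinarith [Real.pi_gt_three]) (integrableOn_const (by simp)) (by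
      intro ξ hξ
      have hη0 : 0 < 2 * Real.pi * ξ := mul_pos hpi hξ.1
      have hη1 : 2 * Real.pi * ξ ≤ ρ := by
        rw [mul_comm, ← le_div_iff₀ hpi]; exact hξ.2
      set η := 2 * Real.pi * ξ
      have hD := discriminant_ge hθ.le hθ' hη0 (hη1.trans (h1.trans (min_le_right _ _)))
      have hlpos := logSymbol_pos (θ := θ) hη0.ne'
      have hlt : logSymbol θ η * t ≤ 1 := by
        calc logSymbol θ η * t ≤ |η| ^ (2 * θ) * t := by
              have := logSymbol_le_rpow θ η; gcongr
          _ ≤ ρ ^ (2 * θ) * t := by rw [abs_of_pos hη0]; gcongr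
          _ = 1 := hρt
      have := le_oscillator_of_mul_le_one ht.le (lt_of_lt_of_le (by positivity) hD) hlt
      gcongr)
  have hvol : ∫ _ in Ioc 0 (ρ / (2 * Real.pi)), (t / 2) ^ 2 = E ^ 2 / (8 * Real.pi) := by
    rw [setIntegral_const, Real.volume_real_Ioc_of_le (by positivity), smul_eq_mul, ← hsq]
    field_simp
    ring
  rw [hvol] at key
  refine abs_le_of_sq_le_sq' (b := ‖u t‖) (a := _) ?_ (norm_nonneg _) |>.2
  refine le_trans ?_ key
  -- The crude `64` makes the final constant a perfect square, `1 / (4 · 64) = (1/16)²`.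
  have : E ^ 2 / 64 ≤ E ^ 2 / (8 * Real.pi) := by
    gcongr
    linarith [Real.pi_lt_four]
  nlinarith [sq_nonneg ‖moment u₁‖]

/-- The region `η ≤ t⁻²` gives only a bounded contribution, so the logarithm comes from the plateau
`m ≈ 1 / l ≈ η^{-1/2}`, on the window `4 / t² ≤ η ≤ t^{-2/3}`. The lower end ensures `l t ≥ 1`, the
upper one `η^{3/2} t ≤ 1`, so that the slow decay costs at most the factor `e^{-4}`. -/
theorem IsMildSolution.sqrt_log_le_norm {u₁ : L2} {u : ℝ → L2}
    (hu : Integrable u₁) (h : IsMildSolution (1 / 4) 0 u₁ u) :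
    ∀ᶠ t : ℝ in atTop,
      Real.exp (-4) / 24 * ‖moment u₁‖ * √(Real.log t) ≤ ‖u t‖ := by
  obtain ⟨δ, hδ0, hδ⟩ := exists_half_norm_moment_le_fourier hu
  have hρ : Tendsto (fun t : ℝ => t ^ (-(2 / 3 : ℝ))) atTop (𝓝 0) :=
    tendsto_rpow_neg_atTop (by positivity)
  have hev := hρ.eventually (ge_mem_nhds (lt_min hδ0 (show (0 : ℝ) < 1 / 512 by norm_num)))
  have hgrow := (tendsto_rpow_atTop (show (0 : ℝ) < 1 / 3 by norm_num)).eventually_ge_atTop 4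
  filter_upwards [hev, hgrow, eventually_ge_atTop 1] with t h1 h4 ht1
  have ht : 0 < t := by linarith
  have hpi : 0 < 2 * Real.pi := by positivity
  have hr0 : 0 < t ^ (-(2 / 3 : ℝ)) := Real.rpow_pos_of_pos ht _
  set r := t ^ (-(2 / 3 : ℝ)) with hr
  have hlog0 : 0 ≤ Real.log t := Real.log_nonneg ht1
  -- The ratio of the ends of the window is `t^{4/3} / 4`, at least `t` as soon as `t^{1/3} ≥ 4`.
  have hratio : t ≤ r / (4 / t ^ 2) := by
    have : t * 4 ≤ r * t ^ 2 := by
      calc t * 4 ≤ t * t ^ (1 / 3 : ℝ) := by gcongr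
        _ = r * t ^ 2 := by
          rw [hr, ← Real.rpow_natCast t 2, ← Real.rpow_add ht]
          nth_rewrite 1 [← Real.rpow_one t]
          rw [← Real.rpow_add ht]
          norm_num
    rw [div_div_eq_mul_div, le_div_iff₀ (by norm_num)]
    exact this
  have hab : 4 / t ^ 2 ≤ r := by
    rw [← one_le_div (by positivity)]
    linarith
  have ha0 : 0 < 4 / t ^ 2 / (2 * Real.pi) := by positivity
  have hb0 : 0 < r / (2 * Real.pi) := by positivity
  have hab' : 4 / t ^ 2 / (2 * Real.pi) ≤ r / (2 * Real.pi) := by gcongr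
  set c := (Real.exp (-4) / 3) ^ 2 / (2 * Real.pi) with hc
  have hii : IntervalIntegrable (fun ξ : ℝ => c * ξ⁻¹) volume
      (4 / t ^ 2 / (2 * Real.pi)) (r / (2 * Real.pi)) :=
    (intervalIntegrable_inv_iff.2
      (Or.inr (notMem_uIcc_of_lt ha0 hb0))).const_mul c
  have key := h.setIntegral_le_norm_sq (by norm_num) hδ ht.le (a := 4 / t ^ 2 / (2 * Real.pi))
    (b := r / (2 * Real.pi)) (φ := fun ξ => c * ξ⁻¹) ha0.le (by
      rw [div_le_iff₀ hpi]
      have := h1.trans (min_le_left _ _)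
      nlinarith [Real.pi_gt_three])
      ((intervalIntegrable_iff_integrableOn_Ioc_of_le hab').1 hii) (by
      intro ξ hξ
      have hξ0 : 0 < ξ := ha0.trans hξ.1
      have hη0 : 0 < 2 * Real.pi * ξ := mul_pos hpi hξ0
      have hη1 : 2 * Real.pi * ξ ≤ r := by
        rw [mul_comm, ← le_div_iff₀ hpi]; exact hξ.2
      have hη2 : 4 / t ^ 2 ≤ 2 * Real.pi * ξ := by
        rw [mul_comm, ← div_le_iff₀ hpi]; exact hξ.1.le
      have hcη : c * ξ⁻¹ = (Real.exp (-4) / 3) ^ 2 / (2 * Real.pi * ξ) := by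
        rw [hc]; field_simp
      rw [hcη]
      set η := 2 * Real.pi * ξ
      have hη512 : η ≤ 1 / 512 := hη1.trans (h1.trans (min_le_right _ _))
      have hD := discriminant_ge (by norm_num : (0 : ℝ) ≤ 1 / 4) (by norm_num) hη0 hη512
      have hpow : |η| ^ (2 * (1 / 4 : ℝ)) = √η := by
        rw [abs_of_pos hη0, Real.sqrt_eq_rpow]; norm_num
      have hl1 := logSymbol_le_rpow (1 / 4) η
      have hl2 := rpow_div_two_le_logSymbol (ξ := η) (by norm_num : (0 : ℝ) ≤ 1 / 4)
        (by rw [abs_of_pos hη0]; linarith)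
      rw [hpow] at hl1 hl2
      have hlpos := logSymbol_pos (θ := 1 / 4) hη0.ne'
      set l := logSymbol (1 / 4) η
      have hs0 : 0 < √η := Real.sqrt_pos.2 hη0
      have hss : √η ^ 2 = η := Real.sq_sqrt hη0.le
      have hst : 2 ≤ √η * t := by
        refine abs_le_of_sq_le_sq' (a := 2) (b := √η * t) ?_ (by positivity) |>.2
        rw [mul_pow, hss]
        rw [div_le_iff₀ (by positivity)] at hη2
        linarith
      have hlt : 1 ≤ l * t := by nlinarith
      have hexp : 2 * η ^ 2 / l * t ≤ 4 := by
        have h5 : η * √η * t ≤ 1 := by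
          calc η * √η * t = η ^ (3 / 2 : ℝ) * t := by
                rw [Real.sqrt_eq_rpow]
                nth_rewrite 1 [← Real.rpow_one η]
                rw [← Real.rpow_add hη0]
                norm_num
            _ ≤ r ^ (3 / 2 : ℝ) * t := by gcongr
            _ = 1 := by
                rw [hr, ← Real.rpow_mul ht.le]
                norm_num
                rw [Real.rpow_neg_one, inv_mul_cancel₀ ht.ne']
        rw [div_mul_eq_mul_div, div_le_iff₀ hlpos]
        have h6 : 2 * η ^ 2 * t = 2 * √η * (η * √η * t) := by
          linear_combination (-2 * η * t) * hss
        rw [h6]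
        nlinarith
      have hosc := le_oscillator_of_one_le_mul hlpos ht.le hD hlt
      have hlow : Real.exp (-4) / (3 * √η) ≤ oscillator l η t := by
        refine le_trans ?_ hosc
        gcongr
      calc (Real.exp (-4) / 3) ^ 2 / η = (Real.exp (-4) / (3 * √η)) ^ 2 := by
            rw [div_pow, div_pow, mul_pow, hss, div_div]
        _ ≤ _ := by gcongr)
  have hval : ∫ ξ in Ioc (4 / t ^ 2 / (2 * Real.pi)) (r / (2 * Real.pi)), c * ξ⁻¹ =
      c * Real.log (r / (4 / t ^ 2)) := by
    rw [← intervalIntegral.integral_of_le hab', intervalIntegral.integral_const_mul,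
      integral_inv_of_pos ha0 hb0, div_div_div_cancel_right₀ hpi.ne']
  rw [hval] at key
  refine abs_le_of_sq_le_sq' (b := ‖u t‖) (a := _) ?_ (norm_nonneg _) |>.2
  refine le_trans ?_ key
  have hlog : Real.log t ≤ Real.log (r / (4 / t ^ 2)) := Real.log_le_log ht hratio
  have hc' : (Real.exp (-4) / 3) ^ 2 / 8 ≤ c := by
    rw [hc]
    gcongr
    linarith [Real.pi_lt_four]
  rw [mul_pow, mul_pow, Real.sq_sqrt hlog0]
  calc (Real.exp (-4) / 24) ^ 2 * ‖moment u₁‖ ^ 2 * Real.log t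
      ≤ (‖moment u₁‖ / 2) ^ 2 * ((Real.exp (-4) / 3) ^ 2 / 8 * Real.log t) := by
        have : 0 ≤ Real.exp (-4) ^ 2 * ‖moment u₁‖ ^ 2 * Real.log t := by positivity
        nlinarith
    _ ≤ _ := by gcongr

end LogDampedWave

theorem theorem1p3 (θ : ℝ) (hθ : 1 / 4 ≤ θ) (hθ' : θ ≤ 1 / 3) :
    ∃ K₁ K₂ T : ℝ, 0 < K₁ ∧ 0 < K₂ ∧
      ∀ u₁ : LogDampedWave.L2, LogDampedWave.MemWeightedL1 (2 * θ) u₁ →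
      ∀ u : ℝ → LogDampedWave.L2, LogDampedWave.IsMildSolution θ 0 u₁ u →
        (1 / 4 < θ →
          (∀ t : ℝ, T ≤ t →
            ‖u t‖ ≤ K₂ * (1 / √(4 * θ - 1) * ‖LogDampedWave.moment u₁‖ +
              LogDampedWave.weightedL1Norm (2 * θ) u₁) * t ^ ((4 * θ - 1) / (4 * θ))) ∧
          (∀ᶠ t : ℝ in Filter.atTop,
            K₁ * ‖LogDampedWave.moment u₁‖ * t ^ ((4 * θ - 1) / (4 * θ)) ≤ ‖u t‖)) ∧
        (θ = 1 / 4 →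
          (∀ t : ℝ, T ≤ t →
            ‖u t‖ ≤ K₂ * (‖LogDampedWave.moment u₁‖ +
              LogDampedWave.weightedL1Norm (2 * θ) u₁) * √(Real.log t)) ∧
          (∀ᶠ t : ℝ in Filter.atTop,
            K₁ * ‖LogDampedWave.moment u₁‖ * √(Real.log t) ≤ ‖u t‖)) := by
  -- `K₂` may depend on `θ`, so it takes up the blow-up as `θ` tends to `1/4`. The moment term in
  -- the upper bounds is mere slack: the weighted norm alone already suffices.
  rcases hθ.eq_or_lt with rfl | hlt
  · refine ⟨Real.exp (-4) / 24, √74, 3, by positivity, by positivity, fun u₁ hu₁ u hu =>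
      ⟨fun h => absurd h (lt_irrefl _), fun _ => ⟨fun t ht => ?_, hu.sqrt_log_le_norm hu₁.1⟩⟩⟩
    refine (hu.norm_le_sqrt_log hu₁ ht).trans ?_
    gcongr
    linarith [norm_nonneg (LogDampedWave.moment u₁)]
  · have h4 : 0 < 4 * θ - 1 := by linarith
    refine ⟨1 / 16, √(2 + 36 / (4 * θ - 1)), 1, by norm_num, by positivity, fun u₁ hu₁ u hu =>
      ⟨fun _ => ⟨fun t ht => ?_, hu.rpow_le_norm (by linarith) hθ' hu₁.1⟩,
        fun h => absurd h hlt.ne'⟩⟩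
    refine (hu.norm_le_rpow hlt hu₁ ht).trans ?_
    have : 0 ≤ t ^ ((4 * θ - 1) / (4 * θ)) := Real.rpow_nonneg (by linarith) _
    gcongr
    exact le_add_of_nonneg_left (by positivity)
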